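/- **Setting.** Let $K\ge 2$, let $(X,Y)$ be a random pair with values in $\mathcal X\times\{1,\dots,K\}$ and law $P$, and let $p_k(x)=\mathbb P(Y=k\mid X=x)$. For a score function $f=(f_1,\dots,f_K):\mathcal X\to\mathbb R^K$ let $F_{f_k}$ be the c.d.f. of $f_k(X)$. Assume that every $F_{p_k}$ is continuous, and put $G(t)=\sum_{k}(1-F_{p_k}(t))$ and, for $\beta\in(0,K)$, $G^{-1}(\beta)=\inf\{t\in[0,1]:G(t)\le\beta\}$. A confidence set is a map $\Gamma:\mathcal X\to 2^{\{1,\dots,K\}}$, with risk $\mathcal R(\Gamma)=\mathbb P(Y\notin\Gamma(X))$. The oracle $\beta$-set is $\Gamma^*_\beta(x)=\{k:G(p_k(x))\le\beta\}$, and $\Gamma_{f,\delta}(x)=\{k:f_k(x)\ge-\delta\}$ for $\delta\in\mathbb R$. Let $\phi:\mathbb R\to\mathbb R$ be convex, $R_\phi(f)=\mathbb E[\sum_k\phi(Z_kf_k(X))]$ with $Z_k=2\cdot\mathbf 1_{\{Y=k\}}-1$, let $f^*$ be a minimizer of $R_\phi$ over all measurable score functions, with finite risk, and put $\Delta R_\phi(f)=R_\phi(f)-R_\phi(f^*)$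 and $$\Delta R^k_\phi(f(x))=p_k(x)\big(\phi(f_k(x))-\phi(f^*_k(x))\big)+(1-p_k(x))\big(\phi(-f_k(x))-\phi(-f^*_k(x))\big).$$ Let $\mathcal F$ be a convex class of measurable score functions. Let $\mathcal D_n=\{(X_i,Y_i)\}_{i\le n}$ be i.i.d. copies of $(X,Y)$ and, independently, $\mathcal D_N$ be $N$ i.i.d. copies of $X$ ($n,N\ge1$). Let $\hat f\in\mathcal F$, a measurable function of $\mathcal D_n$, minimize the empirical $\phi$-risk $\hat R_\phi(f)=\frac1n\sum_{i\le n}\sum_k\phi(Z^i_kf_k(X_i))$, $Z^i_k=2\cdot\mathbf 1_{\{Y_i=k\}}-1$, over $\mathcal F$. Assume that, conditionally on $\mathcal D_n$, the c.d.f.s of $\hat f_1(X),\dots,\hat f_K(X)$ are almost surely continuous. With $\hat G(t)=\frac1N\sum_{X'\in\mathcal D_N}\sum_k\mathbf 1_{\{\hat f_k(X')\ge t\}}$, the empirical $\beta$-set is $\hat\Gamma_\beta(x)=\{k:\hat G(\hat f_k(x))\le\beta\}$, and $\Delta\mathcal R(\hat\Gamma_\beta)=\mathbb P(Y\notin\hat\Gamma_\beta(X)\mid\mathcal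 D_n,\mathcal D_N)-\mathcal R(\Gamma^*_\beta)$. **Theorem.** Let $B\in\mathbb R$, $L\ge0$, $s\ge1$, $\alpha,c_1,c_2,C_0>0$ and $\beta\in(0,K)$. Assume: 1. $|f_k(x)|\le B$ for all $f\in\mathcal F$, all $x$ and all $k$, and $\phi$ is $L$-Lipschitz on $[-B,B]$. 2. $\phi$ is confidence set calibrated: for every $\beta'\in(0,K)$ there is $\delta\in\mathbb R$ with $\Gamma_{f^*,\delta}=\Gamma^*_{\beta'}$ almost surely; and for some $\delta^*\in\mathbb R$ with $\Gamma_{f^*,\delta^*}=\Gamma^*_\beta$ almost surely, one has, almost surely for every $k$, $|p_k(X)-G^{-1}(\beta)|^s\le C_0\,\Delta R^k_\phi(-\delta^*)$, where $-\delta^*$ stands for the constant score $(-\delta^*,\dots,-\delta^*)$. 3. The modulus of convexity of $R_\phi$ on $\mathcal F$, $$\delta(\varepsilon)=\inf\Big\{\tfrac{R_\phi(f)+R_\phi(g)}2-R_\phi\big(\tfrac{f+g}2\big):\ f,g\in\mathcal F,\ \sum_k\mathbb E[(f_k-g_k)^2(X)]\ge\varepsilon^2\Big\},$$ satisfies $\delta(\varepsilon)\ge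 c_1\varepsilon^2$ for all $\varepsilon>0$ ($\inf\emptyset=+\infty$). 4. (Margin conditions $\mathrm M^k_\alpha$) $\mathbb P(0<|p_k(X)-G^{-1}(\beta)|\le t)\le c_2t^\alpha$ for all $t>0$ and all $k$. 5. $2\le M_n<\infty$, where $M_n=\mathcal N(1/n,L_\infty,\mathcal F)$ is the least number of closed balls of radius $1/n$ for the sup norm (over $x$ and $k$) needed to cover $\mathcal F$. Then $$\mathbf E\big[|\Delta\mathcal R(\hat\Gamma_\beta)|\big]\le C\,K^{1-\alpha/(\alpha+s)}\Big\{\inf_{f\in\mathcal F}\Delta R_\phi(f)+\frac{K\log M_n}{n}\Big\}^{\alpha/(\alpha+s)}+C'\frac K{\sqrt N},$$ where $C'>0$ is an absolute constant and $C>0$ depends only on $B,L,s,\alpha$ and on the constants $c_1,c_2,C_0$ of the assumptions. -/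

import Mathlib

open MeasureTheory ProbabilityTheory
open scoped NNReal ENNReal UniformConvergence

namespace ConfSet

noncomputable section

/-- A score function `f = (f_1, ..., f_K) : X → ℝ^K`. -/
abbrev Score (X : Type*) (K : ℕ) := X → Fin K → ℝ

/-- A confidence set, assigning to every `x` a set of labels. -/
abbrev LabelSet (X : Type*) (K : ℕ) := X → Set (Fin K)

section Scores

variable {X : Type*} [MeasurableSpace X] {K : ℕ}

/-- The cumulative distribution function of `f_k(X)`, where `X` has law `μ`. -/
def scoreCDF (μ : Measure X) (f : Score X K) (k : Fin K) (t : ℝ) : ℝ :=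
  μ.real {x | f x k ≤ t}

/-- The sum over `k` of the tail distribution functions `1 - F_{f_k}`. -/
def tailSum (μ : Measure X) (f : Score X K) (t : ℝ) : ℝ :=
  ∑ k, (1 - scoreCDF μ f k t)

/-- The confidence set `Γ_{f,δ}(x) = {k : f_k(x) ≥ -δ}`. -/
def thresholdSet (f : Score X K) (δ : ℝ) : LabelSet X K :=
  fun x => {k | -δ ≤ f x k}

end Scores

section Population

variable {X : Type*} [MeasurableSpace X] {K : ℕ}

/-- The misclassification risk `P(Y ∉ Γ(X))`, where `(X, Y)` has law `P`. -/
def risk (P : Measure (X × Fin K)) (Γ : LabelSet X K) : ℝ :=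
  P.real {z | z.2 ∉ Γ z.1}

/-- The conditional probabilities `p_k(x) = P(Y = k | X = x)`. -/
def condProb [NeZero K] (P : Measure (X × Fin K)) [IsFiniteMeasure P] : Score X K :=
  fun x k => (P.condKernel x).real {k}

/-- `G(t) = ∑_k (1 - F_{p_k}(t))`. -/
def oracleG [NeZero K] (P : Measure (X × Fin K)) [IsFiniteMeasure P] (t : ℝ) : ℝ :=
  tailSum P.fst (condProb P) t

/-- The generalized inverse `G⁻¹(β) = inf {t ∈ [0,1] : G(t) ≤ β}`. -/
def oracleGInv [NeZero K] (P : Measure (X × Fin K)) [IsFiniteMeasure P] (β : ℝ) : ℝ :=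
  sInf {t | t ∈ Set.Icc (0 : ℝ) 1 ∧ oracleG P t ≤ β}

/-- The oracle `β`-set `{k : G(p_k(x)) ≤ β}`. -/
def oracleSet [NeZero K] (P : Measure (X × Fin K)) [IsFiniteMeasure P] (β : ℝ) :
    LabelSet X K :=
  fun x => {k | oracleG P (condProb P x k) ≤ β}

/-- The signed label `Z_k = 2 · 1_{y = k} - 1`. -/
def signedLabel (y k : Fin K) : ℝ := if y = k then 1 else -1

/-- The convex loss `∑_k φ(Z_k f_k(x))` of the score `f` at the point `(x, y)`. -/
def phiLoss (φ : ℝ → ℝ) (f : Score X K) (z : X × Fin K) : ℝ :=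
  ∑ k, φ (signedLabel z.2 k * f z.1 k)

/-- The `φ`-risk `E[∑_k φ(Z_k f_k(X))]`. -/
def phiRisk (P : Measure (X × Fin K)) (φ : ℝ → ℝ) (f : Score X K) : ℝ :=
  ∫ z, phiLoss φ f z ∂P

/-- `f⋆` minimizes the `φ`-risk over all measurable score functions and has finite `φ`-risk.
Competitors whose loss is not integrable are left out: for these the Bochner integral is not
the risk. -/
structure IsPhiMinimizer (P : Measure (X × Fin K)) (φ : ℝ → ℝ) (fstar : Score X K) : Prop where
  measurable : Measurable fstar
  integrable : Integrable (phiLoss φ fstar) P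
  le : ∀ g : Score X K, Measurable g → Integrable (phiLoss φ g) P →
    phiRisk P φ fstar ≤ phiRisk P φ g

/-- `φ` is confidence set calibrated: for each level `β ∈ (0, K)` the oracle `β`-set is a
threshold set of the minimizer `f⋆` of the `φ`-risk. -/
def IsCalibrated [NeZero K] (P : Measure (X × Fin K)) [IsFiniteMeasure P]
    (fstar : Score X K) : Prop :=
  ∀ β ∈ Set.Ioo (0 : ℝ) K, ∃ δ : ℝ,
    ∀ᵐ x ∂P.fst, thresholdSet fstar δ x = oracleSet P β x

/-- The excess `φ`-risk `R_φ(f) - R_φ(f⋆)`. -/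
def excessPhiRisk (P : Measure (X × Fin K)) (φ : ℝ → ℝ) (fstar f : Score X K) : ℝ :=
  phiRisk P φ f - phiRisk P φ fstar

/-- The marginal conditional excess `φ`-risk of the score `f` at the label `k` and the
point `x`. -/
def marginalExcess [NeZero K] (P : Measure (X × Fin K)) [IsFiniteMeasure P] (φ : ℝ → ℝ)
    (fstar f : Score X K) (k : Fin K) (x : X) : ℝ :=
  condProb P x k * (φ (f x k) - φ (fstar x k)) +
    (1 - condProb P x k) * (φ (-(f x k)) - φ (-(fstar x k)))

/-- The modulus of convexity of the `φ`-risk over the class `F`; the infimum of the empty set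
is `+∞`. -/
def convexityModulus (P : Measure (X × Fin K)) (φ : ℝ → ℝ) (F : Set (Score X K)) (ε : ℝ) :
    EReal :=
  ⨅ (f ∈ F) (g ∈ F) (_ : ε ^ 2 ≤ ∑ k, ∫ x, (f x k - g x k) ^ 2 ∂P.fst),
    (((phiRisk P φ f + phiRisk P φ g) / 2 - phiRisk P φ ((1 / 2 : ℝ) • (f + g)) : ℝ) : EReal)

/-- The margin condition `M_α^k` at the level `β`, with constant `c₂`, for the label `k`. -/
def MarginCondition [NeZero K] (P : Measure (X × Fin K)) [IsFiniteMeasure P]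
    (β α c₂ : ℝ) (k : Fin K) : Prop :=
  ∀ t : ℝ, 0 < t →
    P.fst.real {x | 0 < |condProb P x k - oracleGInv P β| ∧
      |condProb P x k - oracleGInv P β| ≤ t} ≤ c₂ * t ^ α

end Population

section Empirical

variable {X : Type*} {K : ℕ}

/-- The least number of closed balls of radius `r`, for the sup norm over `x` and `k`, that cover
`F`. -/
def supCoveringNumber (r : ℝ≥0) (F : Set (Score X K)) : ℕ∞ :=
  Metric.externalCoveringNumber r
    ((UniformFun.ofFun '' F : Set (X →ᵤ (Fin K → ℝ))))

/-- The empirical `φ`-risk of `f` on the labeled sample `d`. -/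
def empPhiRisk {n : ℕ} (φ : ℝ → ℝ) (d : Fin n → X × Fin K) (f : Score X K) : ℝ :=
  (1 / (n : ℝ)) * ∑ i, phiLoss φ f (d i)

/-- `fhat` is an empirical risk minimizer over `F`: a measurable map of the labeled sample of
size `n`, with values in the minimizers over `F` of the empirical `φ`-risk. -/
structure IsERM [MeasurableSpace X] {n : ℕ} (φ : ℝ → ℝ) (F : Set (Score X K))
    (fhat : (Fin n → X × Fin K) → Score X K) : Prop where
  measurable : Measurable (Function.uncurry fhat)
  mem : ∀ d, fhat d ∈ F
  le : ∀ d, ∀ f ∈ F, empPhiRisk φ d (fhat d) ≤ empPhiRisk φ d f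

open Classical in
/-- `Ĝ(t) = N⁻¹ ∑_i ∑_k 1_{f_k(X_i) ≥ t}` on the unlabeled sample `u`. -/
def empG {N : ℕ} (u : Fin N → X) (f : Score X K) (t : ℝ) : ℝ :=
  (1 / (N : ℝ)) * ∑ i, ∑ k, if t ≤ f (u i) k then (1 : ℝ) else 0

/-- The empirical `β`-set `{k : Ĝ(f_k(x)) ≤ β}` built on the score `f`. -/
def empSet {N : ℕ} (u : Fin N → X) (f : Score X K) (β : ℝ) : LabelSet X K :=
  fun x => {k | empG u f (f x k) ≤ β}

end Empirical

end

end ConfSet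

/-! Both the empirical and the oracle `β`-set are compared with an intermediate one: the level set
of the fitted score computed from its true tail sum instead of `Ĝ`. A difference of risks is at most
the mass, summed over labels, of the symmetric difference of the two sets, so the task is to bound
two such masses and the excess `φ`-risk of the fitted score.

Empirical against intermediate set (`integral_deviationBound_le`). A label is misplaced only where
`Ĝ` deviates from the tail sum by at least the distance of the tail sum to `β`. The indicator of
this event is dominated by a quotient whose mean over the unlabeled sample needs only the variance
bound `K²/N` for `Ĝ(t)`. The tail sum transports the sum of the score laws to Lebesgue measure on
`(0, K]` (`map_tailSum`), so averaging over `x` leaves a Cauchy integral of scale `K/√N`. There is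
no logarithm, and no density is needed.

Intermediate against oracle set (`sum_measureReal_levelSet_symmDiff_le`). Both have expected size
`β`, so the two halves of their symmetric difference have equal mass and bounding one half suffices.
On one of the halves the calibration threshold `-δ` lies between `f⋆_k` and `f_k`. By convexity the
marginal excess risk of `f` there is at least that of the constant `-δ`, which calibration bounds
below by a power of `|p_k - G⁻¹(β)|`. The margin condition handles the points where this distance is
small, and balancing the two contributions gives the exponent `α/(α+s)`.

Excess risk (`integral_excessPhiRisk_erm_le`). The quadratic modulus bounds the squared `L²`
distance of two scores by their excesses over the best risk in the class, so the variance of a loss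
increment is controlled by its mean. An exponential moment of the mean minus twice the empirical
mean, summed over a finite net, then gives the fast rate `K log M_n / n` with factor one in front of
the approximation error. Jensen's inequality for the concave power combines the bounds. -/

namespace ConfSet

open Filter Topology Set

/-! ### Probability integral transform for finite measures on the line -/

section TailTransform

variable {ν : Measure ℝ} [IsFiniteMeasure ν]

theorem antitone_measureReal_Ioi : Antitone fun t => ν.real (Ioi t) :=
  fun _ _ h => measureReal_mono (Ioi_subset_Ioi h)

theorem measureReal_Ioi_eq (t : ℝ) : ν.real (Ioi t) = ν.real univ - ν.real (Iic t) := by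
  rw [← compl_Iic, measureReal_compl measurableSet_Iic]

theorem tendsto_measureReal_Ioi_atTop : Tendsto (fun t => ν.real (Ioi t)) atTop (𝓝 0) := by
  have h : Tendsto (fun t => ν.real (Iic t)) atTop (𝓝 (ν.real univ)) :=
    (ENNReal.tendsto_toReal (measure_ne_top _ _)).comp (tendsto_measure_Iic_atTop ν)
  simpa [measureReal_Ioi_eq] using h.const_sub (ν.real univ)

theorem exists_lt_measureReal_Ioi {u : ℝ} (hu : u < ν.real univ) : ∃ t, u < ν.real (Ioi t) := by
  have h : Tendsto (fun t => ν.real (Ici t)) atBot (𝓝 (ν.real univ)) :=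
    (ENNReal.tendsto_toReal (measure_ne_top _ _)).comp (tendsto_measure_Ici_atBot ν)
  obtain ⟨t, ht⟩ := ((tendsto_order.1 h).1 u hu).exists
  exact ⟨t - 1, ht.trans_le (measureReal_mono (Ici_subset_Ioi.2 (by linarith)))⟩

theorem measureReal_Ici_of_continuous (hc : Continuous fun t => ν.real (Ioi t)) (t : ℝ) :
    ν.real (Ici t) = ν.real (Ioi t) := by
  refine le_antisymm ?_ (measureReal_mono Ioi_subset_Ici_self)
  have h : Tendsto (fun s => ν.real (Ioi s)) (𝓝[<] t) (𝓝 (ν.real (Ioi t))) :=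
    (hc.tendsto t).mono_left nhdsWithin_le_nhds
  refine ge_of_tendsto h ?_
  filter_upwards [self_mem_nhdsWithin] with s hs
  exact measureReal_mono (Ici_subset_Ioi.2 hs)

theorem setOf_measureReal_Ioi_le (hc : Continuous fun t => ν.real (Ioi t)) {u : ℝ}
    (h0 : 0 < u) (hu : u < ν.real univ) :
    ∃ t₀, {t | ν.real (Ioi t) ≤ u} = Ici t₀ ∧ ν.real (Ici t₀) = u := by
  set S := {t | ν.real (Ioi t) ≤ u} with hS
  have hne : S.Nonempty := by
    obtain ⟨t, ht⟩ := ((tendsto_order.1 (tendsto_measureReal_Ioi_atTop (ν := ν))).2 u h0).exists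
    exact ⟨t, ht.le⟩
  have hbdd : BddBelow S := by
    obtain ⟨t, ht⟩ := exists_lt_measureReal_Ioi hu
    refine ⟨t, fun s hs => ?_⟩
    by_contra! hst
    exact absurd (antitone_measureReal_Ioi (ν := ν) hst.le) (not_le.2 (lt_of_le_of_lt hs ht))
  have hcl : IsClosed S := isClosed_le hc continuous_const
  have hmem : sInf S ∈ S := hcl.csInf_mem hne hbdd
  refine ⟨sInf S, ?_, ?_⟩
  · ext t
    refine ⟨fun ht => csInf_le hbdd ht, fun ht => ?_⟩
    exact (antitone_measureReal_Ioi (ν := ν) ht).trans hmem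
  · rw [measureReal_Ici_of_continuous hc]
    refine le_antisymm hmem ?_
    -- To the left of the infimum the tail exceeds `u`, so the left limit is at least `u`.
    have h : Tendsto (fun s => ν.real (Ioi s)) (𝓝[<] (sInf S)) (𝓝 (ν.real (Ioi (sInf S)))) :=
      (hc.tendsto _).mono_left nhdsWithin_le_nhds
    refine ge_of_tendsto h ?_
    filter_upwards [self_mem_nhdsWithin] with s hs
    by_contra! hlt
    exact absurd (csInf_le hbdd (show s ∈ S from hlt.le)) (not_le.2 hs)

/-- The tail function of a finite measure with continuous tails transports it to the Lebesgue
measure on `(0, ν(ℝ)]`. -/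
theorem map_measureReal_Ioi (hc : Continuous fun t => ν.real (Ioi t)) :
    ν.map (fun t => ν.real (Ioi t)) = volume.restrict (Ioc 0 (ν.real univ)) := by
  refine Measure.ext_of_Iic _ _ fun u => ?_
  rw [Measure.map_apply hc.measurable measurableSet_Iic, Measure.restrict_apply measurableSet_Iic]
  have hpos : ∀ u, 0 < u → u < ν.real univ →
      ν ((fun t => ν.real (Ioi t)) ⁻¹' Iic u) = ENNReal.ofReal u := by
    intro u h0 hu
    obtain ⟨t, h1, h2⟩ := setOf_measureReal_Ioi_le hc h0 hu
    change ν {t | ν.real (Ioi t) ≤ u} = _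
    rw [h1, ← h2, ofReal_measureReal]
  rcases le_or_gt (ν.real univ) u with hu | hu
  · have h1 : (fun t => ν.real (Ioi t)) ⁻¹' Iic u = univ :=
      eq_univ_of_forall fun t => (measureReal_mono (subset_univ _)).trans hu
    have h2 : Iic u ∩ Ioc 0 (ν.real univ) = Ioc 0 (ν.real univ) :=
      inter_eq_self_of_subset_right fun x hx => hx.2.trans hu
    rw [h1, h2, Real.volume_Ioc, sub_zero, ofReal_measureReal]
  · have h2 : Iic u ∩ Ioc 0 (ν.real univ) = Ioc 0 u := by
      ext x
      simp only [mem_inter_iff, mem_Iic, mem_Ioc]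
      constructor
      · rintro ⟨h, h', -⟩; exact ⟨h', h⟩
      · rintro ⟨h, h'⟩; exact ⟨h', h, h'.trans hu.le⟩
    rw [h2, Real.volume_Ioc, sub_zero]
    rcases lt_or_ge 0 u with h0 | h0
    · exact hpos u h0 hu
    · rw [ENNReal.ofReal_of_nonpos h0]
      rcases (measureReal_nonneg (μ := ν) (s := univ)).eq_or_lt with hm | hm
      · have : ν univ = 0 := by
          rwa [eq_comm, measureReal_eq_zero_iff] at hm
        exact measure_mono_null (subset_univ _) this
      -- For `u ≤ 0` the sublevel set lies in those of every small `v > 0`, which have measure `v`;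
      -- let `v` decrease to `0`.
      · refine le_antisymm ?_ bot_le
        have h : Tendsto (fun v => ENNReal.ofReal v) (𝓝[>] (0 : ℝ)) (𝓝 (ENNReal.ofReal 0)) :=
          (ENNReal.continuous_ofReal.tendsto 0).mono_left nhdsWithin_le_nhds
        rw [ENNReal.ofReal_zero] at h
        refine ge_of_tendsto h ?_
        filter_upwards [self_mem_nhdsWithin, Ioo_mem_nhdsGT hm] with v hv hv'
        rw [← hpos v hv'.1 hv'.2]
        exact measure_mono fun x hx => le_trans hx (h0.trans hv'.1.le)

end TailTransform

/-! ### Tail sums and level sets of a score -/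

section ScoreLaw

variable {X : Type*} [MeasurableSpace X] {K : ℕ}

/-- The sum over `k` of the laws of `f_k(X)`. -/
noncomputable def scoreMeasure (μ : Measure X) (f : Score X K) : Measure ℝ :=
  ∑ k, μ.map (fun x => f x k)

theorem continuous_tailSum {μ : Measure X} {f : Score X K}
    (hc : ∀ k, Continuous (scoreCDF μ f k)) : Continuous (tailSum μ f) := by
  unfold tailSum
  exact continuous_finsetSum _ fun k _ => continuous_const.sub (hc k)

variable {μ : Measure X} [IsProbabilityMeasure μ] {f : Score X K}

instance : IsFiniteMeasure (scoreMeasure μ f) := by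
  unfold scoreMeasure; infer_instance

theorem measurable_score (hf : Measurable f) (k : Fin K) : Measurable fun x => f x k :=
  (measurable_pi_apply k).comp hf

theorem scoreMeasure_real_apply (hf : Measurable f) {s : Set ℝ} (hs : MeasurableSet s) :
    (scoreMeasure μ f).real s = ∑ k, μ.real {x | f x k ∈ s} := by
  rw [measureReal_def, scoreMeasure, Measure.finsetSum_apply, ENNReal.toReal_sum]
  · refine Finset.sum_congr rfl fun k _ => ?_
    rw [Measure.map_apply (measurable_score hf k) hs]; rfl
  · intro k _
    rw [Measure.map_apply (measurable_score hf k) hs]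
    exact measure_ne_top _ _

theorem scoreMeasure_real_univ (hf : Measurable f) : (scoreMeasure μ f).real univ = K := by
  simp [scoreMeasure_real_apply hf MeasurableSet.univ]

theorem scoreMeasure_real_Ioi (hf : Measurable f) (t : ℝ) :
    (scoreMeasure μ f).real (Ioi t) = tailSum μ f t := by
  rw [scoreMeasure_real_apply hf measurableSet_Ioi, tailSum]
  refine Finset.sum_congr rfl fun k _ => ?_
  have : {x | f x k ∈ Ioi t} = {x | f x k ≤ t}ᶜ := by ext x; simp
  rw [this, scoreCDF, probReal_compl_eq_one_sub]
  exact measurableSet_le (measurable_score hf k) measurable_const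

theorem tailSum_eq_sum_Ici (hf : Measurable f) (hc : ∀ k, Continuous (scoreCDF μ f k)) (t : ℝ) :
    tailSum μ f t = ∑ k, μ.real {x | t ≤ f x k} := by
  have hc' : Continuous fun t => (scoreMeasure μ f).real (Ioi t) := by
    simpa only [scoreMeasure_real_Ioi hf] using continuous_tailSum hc
  rw [← scoreMeasure_real_Ioi hf, ← measureReal_Ici_of_continuous hc',
    scoreMeasure_real_apply hf measurableSet_Ici]
  rfl

theorem map_tailSum (hf : Measurable f) (hc : ∀ k, Continuous (scoreCDF μ f k)) :
    (scoreMeasure μ f).map (tailSum μ f) = volume.restrict (Ioc 0 (K : ℝ)) := by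
  have hc' : Continuous fun t => (scoreMeasure μ f).real (Ioi t) := by
    simpa only [scoreMeasure_real_Ioi hf] using continuous_tailSum hc
  simpa only [scoreMeasure_real_Ioi hf, scoreMeasure_real_univ hf] using map_measureReal_Ioi hc'

/-- The set of labels whose score has tail sum at most `β`. -/
def levelSet (μ : Measure X) (f : Score X K) (β : ℝ) : LabelSet X K :=
  fun x => {k | tailSum μ f (f x k) ≤ β}

/-- Continuity makes the expected size exactly `β`, whatever the score. This common size is what
allows two level sets to be compared. -/
theorem levelSet_eq_threshold (hf : Measurable f) (hc : ∀ k, Continuous (scoreCDF μ f k))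
    {β : ℝ} (hβ : β ∈ Ioo (0 : ℝ) K) :
    ∃ t₀, (∀ x k, k ∈ levelSet μ f β x ↔ t₀ ≤ f x k) ∧ ∑ k, μ.real {x | t₀ ≤ f x k} = β := by
  have hc' : Continuous fun t => (scoreMeasure μ f).real (Ioi t) := by
    simpa only [scoreMeasure_real_Ioi hf] using continuous_tailSum hc
  obtain ⟨t, h1, h2⟩ := setOf_measureReal_Ioi_le hc' hβ.1
    (by rw [scoreMeasure_real_univ hf]; exact hβ.2)
  refine ⟨t, fun x k => ?_, ?_⟩
  · have := Set.ext_iff.1 h1 (f x k)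
    simp only [scoreMeasure_real_Ioi hf] at this
    exact this
  · rw [← h2, scoreMeasure_real_apply hf measurableSet_Ici]
    rfl

/-- Change of variables through the transport to Lebesgue measure: the law of the score disappears
from such averages. -/
theorem sum_integral_comp_tailSum (hf : Measurable f) (hc : ∀ k, Continuous (scoreCDF μ f k))
    {h : ℝ → ℝ} (hh : Measurable h) {C : ℝ} (hb : ∀ u, |h u| ≤ C) :
    ∑ k, ∫ x, h (tailSum μ f (f x k)) ∂μ = ∫ u in Ioc 0 (K : ℝ), h u := by
  have hm := (continuous_tailSum hc).measurable
  rw [← map_tailSum hf hc, integral_map hm.aemeasurable hh.aestronglyMeasurable, scoreMeasure,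
    integral_finsetSum_measure]
  · refine Finset.sum_congr rfl fun k _ => ?_
    exact (integral_map (measurable_score hf k).aemeasurable
      (hh.comp hm).aestronglyMeasurable).symm
  · intro k _
    exact Integrable.of_bound (hh.comp hm).aestronglyMeasurable C (ae_of_all _ fun t => hb _)

end ScoreLaw

/-! ### Variance of a sample mean -/

section SampleMean

variable {X : Type*} [MeasurableSpace X] {μ : Measure X} [IsProbabilityMeasure μ]

theorem integral_sampleMean_sub_sq_le {N : ℕ} (hN : 0 < N) {g : X → ℝ} (hg : Measurable g)
    {b : ℝ} (hb : ∀ x, g x ∈ Icc 0 b) :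
    ∫ u, ((1 / (N : ℝ)) * ∑ i, g (u i) - ∫ x, g x ∂μ) ^ 2 ∂Measure.pi (fun _ : Fin N => μ)
      ≤ b ^ 2 / N := by
  have hN' : (N : ℝ) ≠ 0 := by positivity
  have hLp : MemLp g 2 μ := MemLp.of_bound hg.aestronglyMeasurable b
    (ae_of_all _ fun x => by rw [Real.norm_eq_abs, abs_of_nonneg (hb x).1]; exact (hb x).2)
  have hvar := variance_sum_pi (μ := fun _ : Fin N => μ) (X := fun _ => g) fun _ => hLp
  have hgm : ∀ i : Fin N, Measurable fun u : Fin N → X => g (u i) := fun i =>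
    hg.comp (measurable_pi_apply i)
  have hint : ∀ i : Fin N,
      Integrable (fun u : Fin N → X => g (u i)) (Measure.pi fun _ : Fin N => μ) := fun i =>
    Integrable.of_bound (hgm i).aestronglyMeasurable b
      (ae_of_all _ fun x => by rw [Real.norm_eq_abs, abs_of_nonneg (hb _).1]; exact (hb _).2)
  have hmean : ∫ u, ∑ i, g (u i) ∂Measure.pi (fun _ : Fin N => μ) = N * ∫ x, g x ∂μ := by
    rw [integral_finsetSum _ fun i _ => hint i]
    have : ∀ i : Fin N, ∫ u, g (u i) ∂Measure.pi (fun _ : Fin N => μ) = ∫ x, g x ∂μ := fun i =>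
      integral_comp_eval (μ := fun _ : Fin N => μ) (i := i) hg.aestronglyMeasurable
    simp [this]
  have hV : Var[fun u => ∑ i, g (u i); Measure.pi (fun _ : Fin N => μ)] = N * Var[g; μ] := by
    have h : (∑ i : Fin N, fun u : Fin N → X => g (u i)) = fun u => ∑ i, g (u i) := by
      ext u; simp
    rw [h] at hvar
    simpa using hvar
  rw [variance_eq_integral (Finset.measurable_sum _ fun i _ => hgm i).aemeasurable, hmean] at hV
  have hle : Var[g; μ] ≤ b ^ 2 := by
    refine (variance_le_sq_of_bounded (ae_of_all _ hb) hg.aemeasurable).trans ?_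
    nlinarith [sq_nonneg b]
  have heq : ∀ u : Fin N → X, ((1 / (N : ℝ)) * ∑ i, g (u i) - ∫ x, g x ∂μ) ^ 2
      = (1 / (N : ℝ) ^ 2) * (∑ i, g (u i) - N * ∫ x, g x ∂μ) ^ 2 := by
    intro u
    field_simp
  simp_rw [heq]
  rw [integral_const_mul, hV]
  calc 1 / (N : ℝ) ^ 2 * (N * Var[g; μ]) = Var[g; μ] / N := by field_simp
    _ ≤ b ^ 2 / N := by gcongr

end SampleMean

/-- A rescaled Cauchy density; its mass is the source of the absolute constant `2π`. -/
theorem integral_inv_sq_add_sq {a : ℝ} (ha : 0 < a) (β : ℝ) :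
    Integrable (fun u : ℝ => 2 * a ^ 2 / (a ^ 2 + (u - β) ^ 2)) ∧
      ∫ u : ℝ, 2 * a ^ 2 / (a ^ 2 + (u - β) ^ 2) = 2 * Real.pi * a := by
  have heq : ∀ u : ℝ, 2 * a ^ 2 / (a ^ 2 + (u - β) ^ 2) = 2 * (1 + ((u - β) / a) ^ 2)⁻¹ := by
    intro u
    have : a ^ 2 + (u - β) ^ 2 ≠ 0 := by positivity
    field_simp
  simp_rw [heq]
  constructor
  · exact ((integrable_inv_one_add_sq.comp_div ha.ne').comp_sub_right β).const_mul 2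
  · rw [integral_const_mul, integral_sub_right_eq_self (fun u : ℝ => (1 + (u / a) ^ 2)⁻¹) β,
      Measure.integral_comp_div (fun u : ℝ => (1 + u ^ 2)⁻¹) a, integral_univ_inv_one_add_sq,
      abs_of_pos ha, smul_eq_mul]
    ring

/-! ### Empirical against population level sets -/

section EmpiricalTail

variable {X : Type*} {K N : ℕ}

open Classical in
theorem empG_eq_mean (u : Fin N → X) (f : Score X K) (t : ℝ) :
    empG u f t = (1 / (N : ℝ)) * ∑ i, ∑ k, {x | t ≤ f x k}.indicator (fun _ => (1 : ℝ)) (u i) := by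
  simp [empG, Set.indicator_apply]

theorem sum_indicator_mem_Icc (f : Score X K) (t : ℝ) (x : X) :
    ∑ k, {x | t ≤ f x k}.indicator (fun _ => (1 : ℝ)) x ∈ Icc (0 : ℝ) K := by
  constructor
  · exact Finset.sum_nonneg fun k _ => indicator_nonneg (fun _ _ => zero_le_one) _
  · calc _ ≤ ∑ k : Fin K, (1 : ℝ) := Finset.sum_le_sum fun k _ =>
        indicator_le_self' (fun _ _ => zero_le_one) _
      _ = K := by simp

theorem empG_mem_Icc (hN : 0 < N) (u : Fin N → X) (f : Score X K) (t : ℝ) :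
    empG u f t ∈ Icc (0 : ℝ) K := by
  rw [empG_eq_mean]
  have h := fun i => sum_indicator_mem_Icc f t (u i)
  constructor
  · exact mul_nonneg (by positivity) (Finset.sum_nonneg fun i _ => (h i).1)
  · rw [one_div, inv_mul_le_iff₀ (by positivity)]
    exact (Finset.sum_le_sum fun i _ => (h i).2).trans (by simp)

variable [MeasurableSpace X] {μ : Measure X} [IsProbabilityMeasure μ]

theorem tailSum_mem_Icc (f : Score X K) (t : ℝ) : tailSum μ f t ∈ Icc (0 : ℝ) K := by
  constructor
  · exact Finset.sum_nonneg fun k _ => sub_nonneg.2 measureReal_le_one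
  · calc _ ≤ ∑ k : Fin K, (1 : ℝ) := Finset.sum_le_sum fun k _ =>
        sub_le_self _ measureReal_nonneg
      _ = K := by simp

theorem integral_empG_sub_tailSum_sq_le (hN : 0 < N) {f : Score X K} (hf : Measurable f)
    (hc : ∀ k, Continuous (scoreCDF μ f k)) (t : ℝ) :
    ∫ u, (empG u f t - tailSum μ f t) ^ 2 ∂Measure.pi (fun _ : Fin N => μ) ≤ (K : ℝ) ^ 2 / N := by
  have hs : ∀ k, MeasurableSet {x | t ≤ f x k} := fun k =>
    measurableSet_le measurable_const (measurable_score hf k)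
  have hm : Measurable fun x => ∑ k, {x | t ≤ f x k}.indicator (fun _ => (1 : ℝ)) x :=
    Finset.measurable_sum _ fun k _ => measurable_const.indicator (hs k)
  have hmean : ∫ x, ∑ k, {x | t ≤ f x k}.indicator (fun _ => (1 : ℝ)) x ∂μ = tailSum μ f t := by
    rw [tailSum_eq_sum_Ici hf hc, integral_finsetSum]
    · refine Finset.sum_congr rfl fun k _ => ?_
      rw [integral_indicator_const _ (hs k)]; simp
    · exact fun k _ => (integrable_const _).indicator (hs k)
  have := integral_sampleMean_sub_sq_le (μ := μ) hN hm (sum_indicator_mem_Icc f t)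
  simpa only [empG_eq_mean, hmean] using this

/-- An upper bound for the size of the symmetric difference of the empirical and the population
level sets. -/
noncomputable def deviationBound (μ : Measure X) (f : Score X K) (β a : ℝ) (u : Fin N → X) : ℝ :=
  ∑ k, ∫ x, (a ^ 2 + (empG u f (f x k) - tailSum μ f (f x k)) ^ 2) /
    (a ^ 2 + (tailSum μ f (f x k) - β) ^ 2) ∂μ

variable {D : Type*} [MeasurableSpace D]

/-- The score is kept as a family indexed by a parameter because the fitted score varies with the
labeled sample, and the final integral runs over both samples. -/
theorem measurable_tailSum_uncurry {F : D → Score X K} (hF : Measurable (Function.uncurry F)) :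
    Measurable fun p : D × ℝ => tailSum μ (F p.1) p.2 := by
  refine Finset.measurable_sum _ fun k _ => measurable_const.sub ?_
  have hs : MeasurableSet {q : (D × ℝ) × X | F q.1.1 q.2 k ≤ q.1.2} := by
    refine measurableSet_le ?_ (by fun_prop)
    exact (measurable_pi_apply k).comp (hF.comp (by fun_prop : Measurable
      fun q : (D × ℝ) × X => (q.1.1, q.2)))
  exact (measurable_measure_prodMk_left (ν := μ) hs).ennreal_toReal

theorem measurable_empG_uncurry {F : D → Score X K} (hF : Measurable (Function.uncurry F)) :
    Measurable fun p : (D × (Fin N → X)) × ℝ => empG p.1.2 (F p.1.1) p.2 := by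
  classical
  refine measurable_const.mul (Finset.measurable_sum _ fun i _ => Finset.measurable_sum _
    fun k _ => Measurable.ite ?_ measurable_const measurable_const)
  refine measurableSet_le (by fun_prop) ?_
  exact (measurable_pi_apply k).comp (hF.comp (by fun_prop : Measurable
    fun q : (D × (Fin N → X)) × ℝ => (q.1.1, q.1.2 i)))

theorem measurable_tailSum_comp {Q : Type*} [MeasurableSpace Q] {F : D → Score X K}
    (hF : Measurable (Function.uncurry F)) {d : Q → D} {t : Q → ℝ} (hd : Measurable d)
    (ht : Measurable t) : Measurable fun q => tailSum μ (F (d q)) (t q) := by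
  simpa only [Function.comp_def] using
    (measurable_tailSum_uncurry (μ := μ) hF).comp (hd.prodMk ht)

theorem measurable_empG_comp {Q : Type*} [MeasurableSpace Q] {F : D → Score X K}
    (hF : Measurable (Function.uncurry F)) {d : Q → D} {u : Q → Fin N → X} {t : Q → ℝ}
    (hd : Measurable d) (hu : Measurable u) (ht : Measurable t) :
    Measurable fun q => empG (u q) (F (d q)) (t q) := by
  simpa only [Function.comp_def] using
    (measurable_empG_uncurry (N := N) hF).comp ((hd.prodMk hu).prodMk ht)

theorem measurable_deviation_ratio {Q : Type*} [MeasurableSpace Q] {p q : Q → ℝ}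
    (hp : Measurable p) (hq : Measurable q) (a β : ℝ) :
    Measurable fun x => (a ^ 2 + (p x - q x) ^ 2) / (a ^ 2 + (q x - β) ^ 2) := by
  fun_prop

theorem measurable_deviation_integrand {F : D → Score X K}
    (hF : Measurable (Function.uncurry F)) (β a : ℝ) (k : Fin K) :
    Measurable fun p : (D × (Fin N → X)) × X =>
      (a ^ 2 + (empG p.1.2 (F p.1.1) (F p.1.1 p.2 k) - tailSum μ (F p.1.1) (F p.1.1 p.2 k)) ^ 2) /
        (a ^ 2 + (tailSum μ (F p.1.1) (F p.1.1 p.2 k) - β) ^ 2) := by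
  have h0 : Measurable fun p : (D × (Fin N → X)) × X => F p.1.1 p.2 k :=
    (measurable_pi_apply k).comp (hF.comp (by fun_prop : Measurable
      fun q : (D × (Fin N → X)) × X => (q.1.1, q.2)))
  have h1 : Measurable fun p : (D × (Fin N → X)) × X =>
      tailSum μ (F p.1.1) (F p.1.1 p.2 k) :=
    measurable_tailSum_comp (d := fun p : (D × (Fin N → X)) × X => p.1.1) hF (by fun_prop) h0
  have h2 : Measurable fun p : (D × (Fin N → X)) × X =>
      empG p.1.2 (F p.1.1) (F p.1.1 p.2 k) :=
    measurable_empG_comp (d := fun p : (D × (Fin N → X)) × X => p.1.1)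
      (u := fun p : (D × (Fin N → X)) × X => p.1.2) hF (by fun_prop) (by fun_prop) h0
  exact measurable_deviation_ratio h2 h1 a β

theorem measurable_deviationBound {F : D → Score X K} (hF : Measurable (Function.uncurry F))
    (β a : ℝ) :
    Measurable fun p : D × (Fin N → X) => deviationBound μ (F p.1) β a p.2 := by
  refine Finset.measurable_sum _ fun k _ => ?_
  exact ((measurable_deviation_integrand hF β a k).stronglyMeasurable.integral_prod_right
    (ν := μ)).measurable

theorem deviation_integrand_mem_Icc (hN : 0 < N) (f : Score X K) {a : ℝ} (ha : 0 < a) (β t : ℝ)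
    (u : Fin N → X) :
    (a ^ 2 + (empG u f t - tailSum μ f t) ^ 2) / (a ^ 2 + (tailSum μ f t - β) ^ 2) ∈
      Icc 0 ((a ^ 2 + (K : ℝ) ^ 2) / a ^ 2) := by
  refine ⟨by positivity, ?_⟩
  have h1 := empG_mem_Icc hN u f t
  have h2 := tailSum_mem_Icc (μ := μ) f t
  have h3 : (empG u f t - tailSum μ f t) ^ 2 ≤ (K : ℝ) ^ 2 := by
    apply sq_le_sq' <;> linarith [h1.1, h1.2, h2.1, h2.2]
  gcongr
  nlinarith [sq_nonneg (tailSum μ f t - β)]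

theorem deviationBound_mem_Icc (hN : 0 < N) (f : Score X K) {a : ℝ} (ha : 0 < a) (β : ℝ)
    (u : Fin N → X) :
    deviationBound μ f β a u ∈ Icc 0 (K * ((a ^ 2 + (K : ℝ) ^ 2) / a ^ 2)) := by
  have h := fun t => deviation_integrand_mem_Icc (μ := μ) hN f ha β t u
  constructor
  · exact Finset.sum_nonneg fun k _ => integral_nonneg fun x => (h _).1
  · calc deviationBound μ f β a u ≤ ∑ k : Fin K, (a ^ 2 + (K : ℝ) ^ 2) / a ^ 2 := by
          refine Finset.sum_le_sum fun k _ => ?_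
          have := integral_mono_of_nonneg (μ := μ) (ae_of_all _ fun x => (h (f x k)).1)
            (integrable_const ((a ^ 2 + (K : ℝ) ^ 2) / a ^ 2)) (ae_of_all _ fun x => (h _).2)
          simpa using this
      _ = _ := by simp

/-- When `p` and `q` lie on opposite sides of `β`, `|p - q| ≥ |q - β|`, so the quotient is at least
one. The summand `a²` keeps it bounded where `q` is near `β`. -/
theorem sum_measureReal_empSet_symmDiff_le (hN : 0 < N) {f : Score X K} (hf : Measurable f)
    (β : ℝ) {a : ℝ} (ha : 0 < a) (u : Fin N → X) :
    ∑ k, μ.real {x | ¬ (k ∈ empSet u f β x ↔ k ∈ levelSet μ f β x)} ≤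
      deviationBound μ f β a u := by
  refine Finset.sum_le_sum fun k _ => ?_
  -- A single score is treated as a family over `Unit`.
  have hF : Measurable (Function.uncurry fun _ : Unit => f) := hf.comp measurable_snd
  have h0 := measurable_score hf k
  have h1 : Measurable fun x => tailSum μ f (f x k) :=
    measurable_tailSum_comp (d := fun _ => ()) hF measurable_const h0
  have h2 : Measurable fun x => empG u f (f x k) :=
    measurable_empG_comp (d := fun _ => ()) (u := fun _ => u) hF measurable_const
      measurable_const h0
  have hs : MeasurableSet {x | ¬ (k ∈ empSet u f β x ↔ k ∈ levelSet μ f β x)} :=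
    ((measurableSet_le h2 measurable_const).iff (measurableSet_le h1 measurable_const)).compl
  have hb := fun t => deviation_integrand_mem_Icc (μ := μ) hN f ha β t u
  rw [← integral_indicator_one hs]
  refine integral_mono_of_nonneg (ae_of_all _ fun x => indicator_nonneg (fun _ _ => zero_le_one) _)
    (Integrable.of_bound (measurable_deviation_ratio h2 h1 a β).aestronglyMeasurable
      ((a ^ 2 + (K : ℝ) ^ 2) / a ^ 2) (ae_of_all _ fun x => ?_))
    (ae_of_all _ fun x => ?_)
  · rw [Real.norm_eq_abs, abs_of_nonneg (hb _).1]; exact (hb _).2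
  · refine indicator_le' (g := fun x => (a ^ 2 + (empG u f (f x k) - tailSum μ f (f x k)) ^ 2) /
      (a ^ 2 + (tailSum μ f (f x k) - β) ^ 2)) (fun y hy => ?_) (fun y _ => (hb _).1) x
    simp only [Pi.one_apply]
    rw [one_le_div (by positivity)]
    have hy' : ¬ (empG u f (f y k) ≤ β ↔ tailSum μ f (f y k) ≤ β) := hy
    generalize empG u f (f y k) = p at *
    generalize tailSum μ f (f y k) = q at *
    rcases le_or_gt p β with hp | hp <;> rcases le_or_gt q β with hq | hq
    · exact absurd (iff_of_true hp hq) hy'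
    · nlinarith
    · nlinarith
    · exact absurd (iff_of_false hp.not_ge hq.not_ge) hy'

/-- With `a = K/√N`, `a²` equals the variance bound for `Ĝ(t)`. After Fubini the mean numerator is
therefore at most `2a²`, and the transport to Lebesgue measure turns the rest into the Cauchy
integral. -/
theorem integral_deviationBound_le (hN : 0 < N) (hK : 0 < K) {f : Score X K} (hf : Measurable f)
    (hc : ∀ k, Continuous (scoreCDF μ f k)) (β : ℝ) :
    ∫ u, deviationBound μ f β (K / √N) u ∂Measure.pi (fun _ : Fin N => μ) ≤
      2 * Real.pi * (K / √N) := by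
  set a : ℝ := K / √N with ha
  have ha0 : 0 < a := by positivity
  have ha2 : a ^ 2 = (K : ℝ) ^ 2 / N := by
    rw [ha, div_pow, Real.sq_sqrt (by positivity)]
  have hF : Measurable (Function.uncurry fun _ : Unit => f) := hf.comp measurable_snd
  have hb := fun t u => deviation_integrand_mem_Icc (μ := μ) hN f ha0 β t u
  have hmk : ∀ k, Measurable fun p : (Fin N → X) × X =>
      (a ^ 2 + (empG p.1 f (f p.2 k) - tailSum μ f (f p.2 k)) ^ 2) /
        (a ^ 2 + (tailSum μ f (f p.2 k) - β) ^ 2) := fun k => by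
    have h0 : Measurable fun p : (Fin N → X) × X => f p.2 k :=
      (measurable_score hf k).comp measurable_snd
    exact measurable_deviation_ratio
      (measurable_empG_comp (d := fun _ => ()) (u := fun p : (Fin N → X) × X => p.1) hF
        measurable_const measurable_fst h0)
      (measurable_tailSum_comp (d := fun _ => ()) hF measurable_const h0) a β
  have hik : ∀ k, Integrable (fun p : (Fin N → X) × X =>
      (a ^ 2 + (empG p.1 f (f p.2 k) - tailSum μ f (f p.2 k)) ^ 2) /
        (a ^ 2 + (tailSum μ f (f p.2 k) - β) ^ 2)) ((Measure.pi fun _ : Fin N => μ).prod μ) :=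
    fun k => Integrable.of_bound (hmk k).aestronglyMeasurable ((a ^ 2 + (K : ℝ) ^ 2) / a ^ 2)
      (ae_of_all _ fun p => by rw [Real.norm_eq_abs, abs_of_nonneg (hb _ _).1]; exact (hb _ _).2)
  have hin := integral_inv_sq_add_sq ha0 β
  have hem : ∀ t, Measurable fun u : Fin N → X => empG u f t := fun t =>
    measurable_empG_comp (d := fun _ => ()) (u := fun u => u) hF measurable_const
      measurable_id measurable_const
  -- The denominator does not involve the unlabeled sample; only the numerator is averaged.
  have hstep : ∀ t, ∫ u, (a ^ 2 + (empG u f t - tailSum μ f t) ^ 2) /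
      (a ^ 2 + (tailSum μ f t - β) ^ 2) ∂Measure.pi (fun _ : Fin N => μ) ≤
      2 * a ^ 2 / (a ^ 2 + (tailSum μ f t - β) ^ 2) := by
    intro t
    rw [integral_div]
    gcongr
    rw [integral_add (integrable_const _)]
    · have := integral_empG_sub_tailSum_sq_le hN hf hc t
      simp only [integral_const, probReal_univ, smul_eq_mul, one_mul]
      linarith
    · refine Integrable.of_bound ((hem t).sub_const _ |>.pow_const 2).aestronglyMeasurable
        ((K : ℝ) ^ 2) (ae_of_all _ fun u => ?_)
      have h1 := empG_mem_Icc hN u f t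
      have h2 := tailSum_mem_Icc (μ := μ) f t
      rw [Real.norm_eq_abs, abs_of_nonneg (sq_nonneg _)]
      apply sq_le_sq' <;> linarith [h1.1, h1.2, h2.1, h2.2]
  have hbound : ∀ u : ℝ, |2 * a ^ 2 / (a ^ 2 + (u - β) ^ 2)| ≤ 2 := by
    intro u
    rw [abs_of_nonneg (by positivity), div_le_iff₀ (by positivity)]
    nlinarith [sq_nonneg (u - β)]
  have hmeas : Measurable fun u : ℝ => 2 * a ^ 2 / (a ^ 2 + (u - β) ^ 2) := by fun_prop
  calc ∫ u, deviationBound μ f β a u ∂Measure.pi (fun _ : Fin N => μ)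
      = ∑ k, ∫ u, ∫ x, (a ^ 2 + (empG u f (f x k) - tailSum μ f (f x k)) ^ 2) /
          (a ^ 2 + (tailSum μ f (f x k) - β) ^ 2) ∂μ ∂Measure.pi (fun _ : Fin N => μ) :=
        integral_finsetSum _ fun k _ => (hik k).integral_prod_left
    _ = ∑ k, ∫ x, ∫ u, (a ^ 2 + (empG u f (f x k) - tailSum μ f (f x k)) ^ 2) /
          (a ^ 2 + (tailSum μ f (f x k) - β) ^ 2) ∂Measure.pi (fun _ : Fin N => μ) ∂μ :=
        Finset.sum_congr rfl fun k _ => integral_integral_swap (hik k)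
    _ ≤ ∑ k, ∫ x, 2 * a ^ 2 / (a ^ 2 + (tailSum μ f (f x k) - β) ^ 2) ∂μ := by
        refine Finset.sum_le_sum fun k _ => integral_mono (hik k).integral_prod_right ?_
          fun x => hstep _
        exact Integrable.of_bound (hmeas.comp ((continuous_tailSum hc).measurable.comp
          (measurable_score hf k))).aestronglyMeasurable 2 (ae_of_all _ fun x => hbound _)
    _ = ∫ u in Ioc 0 (K : ℝ), 2 * a ^ 2 / (a ^ 2 + (u - β) ^ 2) :=
        sum_integral_comp_tailSum hf hc hmeas hbound
    _ ≤ ∫ u : ℝ, 2 * a ^ 2 / (a ^ 2 + (u - β) ^ 2) :=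
        setIntegral_le_integral hin.1 (ae_of_all _ fun u => by positivity)
    _ = 2 * Real.pi * a := hin.2

end EmpiricalTail

/-! ### Boundedness and measurability of the convex loss -/

section Loss

variable {X : Type*} {K : ℕ} {φ : ℝ → ℝ} {f : Score X K}

theorem abs_signedLabel (y k : Fin K) : |signedLabel y k| = 1 := by
  unfold signedLabel; split_ifs <;> simp

theorem continuous_of_convexOn (hφ : ConvexOn ℝ univ φ) : Continuous φ :=
  continuousOn_univ.1 (hφ.continuousOn isOpen_univ)

theorem exists_abs_le_of_continuous (hφ : Continuous φ) (B : ℝ) :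
    ∃ C, 0 ≤ C ∧ ∀ u, |u| ≤ B → |φ u| ≤ C := by
  obtain ⟨C, hC⟩ := (isCompact_Icc (a := -B) (b := B)).exists_bound_of_continuousOn hφ.continuousOn
  exact ⟨max C 0, le_max_right _ _, fun u hu => (hC u (abs_le.1 hu)).trans (le_max_left _ _)⟩

theorem abs_signedLabel_mul (y k : Fin K) (u : ℝ) : |signedLabel y k * u| = |u| := by
  rw [abs_mul, abs_signedLabel, one_mul]

theorem exists_abs_phiLoss_le (hφ : Continuous φ) {B : ℝ} :
    ∃ C, ∀ f : Score X K, (∀ x k, |f x k| ≤ B) → ∀ z, |phiLoss φ f z| ≤ C := by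
  obtain ⟨C, -, hC⟩ := exists_abs_le_of_continuous hφ B
  refine ⟨K * C, fun f hB z => (Finset.abs_sum_le_sum_abs _ _).trans ?_⟩
  refine (Finset.sum_le_sum fun k _ => hC _ ?_).trans (le_of_eq (b := ↑K * C) (by simp))
  rw [abs_signedLabel_mul]; exact hB _ _

variable [MeasurableSpace X]

theorem measurable_signedLabel (k : Fin K) : Measurable fun z : X × Fin K => signedLabel z.2 k :=
  (measurable_of_countable (fun y : Fin K => signedLabel y k)).comp measurable_snd

theorem measurable_phiLoss_term (hφ : Continuous φ) (hf : Measurable f) (k : Fin K) :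
    Measurable fun z : X × Fin K => φ (signedLabel z.2 k * f z.1 k) :=
  hφ.measurable.comp ((measurable_signedLabel k).mul ((measurable_score hf k).comp measurable_fst))

theorem measurable_phiLoss (hφ : Continuous φ) (hf : Measurable f) : Measurable (phiLoss φ f) :=
  Finset.measurable_sum _ fun k _ => measurable_phiLoss_term hφ hf k

theorem integrable_phiLoss {P : Measure (X × Fin K)} [IsFiniteMeasure P] (hφ : Continuous φ) (hf : Measurable f) {B : ℝ}
    (hB : ∀ x k, |f x k| ≤ B) : Integrable (phiLoss φ f) P := by
  obtain ⟨C, hC⟩ := exists_abs_phiLoss_le (X := X) (K := K) hφ (B := B)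
  exact Integrable.of_bound (measurable_phiLoss hφ hf).aestronglyMeasurable C
    (ae_of_all _ fun z => hC f hB z)

theorem excessPhiRisk_nonneg {P : Measure (X × Fin K)} [IsFiniteMeasure P] {fstar : Score X K}
    (hφ : ConvexOn ℝ univ φ) (hmin : IsPhiMinimizer P φ fstar)
    (hf : Measurable f) {B : ℝ} (hB : ∀ x k, |f x k| ≤ B) : 0 ≤ excessPhiRisk P φ fstar f :=
  sub_nonneg.2 (hmin.le f hf (integrable_phiLoss (continuous_of_convexOn hφ) hf hB))

end Loss

/-! ### Marginal conditional excess risks -/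

section ConditionalRisk

variable {X : Type*} [MeasurableSpace X] {K : ℕ} [NeZero K]
  {P : Measure (X × Fin K)} [IsProbabilityMeasure P] {φ : ℝ → ℝ} {f g fstar : Score X K}

theorem condProb_nonneg (x : X) (k : Fin K) : 0 ≤ condProb P x k := measureReal_nonneg

theorem condProb_le_one (x : X) (k : Fin K) : condProb P x k ≤ 1 := measureReal_le_one

theorem sum_condProb (x : X) : ∑ k, condProb P x k = 1 := by
  simp [condProb]

theorem measurable_condProb : Measurable (condProb P) :=
  measurable_pi_iff.2 fun k =>
    ((P.condKernel.measurable_coe (measurableSet_singleton k))).ennreal_toReal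

theorem measurable_condProb_apply (k : Fin K) : Measurable fun x => condProb P x k :=
  measurable_score measurable_condProb k

theorem integral_condKernel_eq_sum (h : X × Fin K → ℝ) (x : X) :
    ∫ y, h (x, y) ∂P.condKernel x = ∑ y, condProb P x y * h (x, y) := by
  rw [integral_fintype (Integrable.of_finite)]
  rfl

theorem integral_eq_integral_sum_condProb {h : X × Fin K → ℝ} (hh : Integrable h P) :
    ∫ z, h z ∂P = ∫ x, ∑ y, condProb P x y * h (x, y) ∂P.fst := by
  rw [← Measure.integral_condKernel hh]
  simp_rw [integral_condKernel_eq_sum]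

theorem integrable_sum_condProb {h : X × Fin K → ℝ} (hh : Integrable h P) :
    Integrable (fun x => ∑ y, condProb P x y * h (x, y)) P.fst := by
  have := hh.integral_condKernel
  simpa only [integral_condKernel_eq_sum] using this

theorem sum_condProb_mul_ite (x : X) (k : Fin K) (a b : ℝ) :
    ∑ y, condProb P x y * (if y = k then a else b) =
      condProb P x k * a + (1 - condProb P x k) * b := by
  have h : ∀ y, condProb P x y * (if y = k then a else b) =
      (if y = k then condProb P x y * (a - b) else 0) + condProb P x y * b := by
    intro y; split_ifs <;> ring
  simp_rw [h, Finset.sum_add_distrib, ← Finset.sum_mul, sum_condProb]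
  simp
  ring

/-- The `k`-th term of the loss depends on `y` only through whether `y = k`, so the conditional risk
splits into `K` binary risks. -/
theorem sum_condProb_mul_phiLoss_sub (x : X) :
    ∑ y, condProb P x y * (phiLoss φ f (x, y) - phiLoss φ fstar (x, y)) =
      ∑ k, marginalExcess P φ fstar f k x := by
  simp_rw [phiLoss, ← Finset.sum_sub_distrib, Finset.mul_sum]
  rw [Finset.sum_comm]
  refine Finset.sum_congr rfl fun k _ => ?_
  rw [marginalExcess, ← sum_condProb_mul_ite]
  refine Finset.sum_congr rfl fun y _ => ?_
  unfold signedLabel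
  split_ifs <;> simp

theorem measurable_marginalExcess (hφ : Continuous φ) (hf : Measurable f)
    (hs : Measurable fstar) (k : Fin K) : Measurable (marginalExcess P φ fstar f k) := by
  have h1 := measurable_condProb_apply (P := P) k
  have h2 := measurable_score hf k
  have h3 := measurable_score hs k
  have h4 := hφ.measurable
  unfold marginalExcess
  exact (h1.mul ((h4.comp h2).sub (h4.comp h3))).add
    ((h1.const_sub 1).mul ((h4.comp h2.neg).sub (h4.comp h3.neg)))

/-- The minimizer of the `φ`-risk minimizes every marginal conditional risk almost surely. -/
theorem marginalExcess_nonneg_ae (hφ : ConvexOn ℝ univ φ) (hmin : IsPhiMinimizer P φ fstar)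
    (hf : Measurable f) {B : ℝ} (hB : ∀ x k, |f x k| ≤ B) (k : Fin K) :
    ∀ᵐ x ∂P.fst, 0 ≤ marginalExcess P φ fstar f k x := by
  classical
  have hc := continuous_of_convexOn hφ
  have hme := measurable_marginalExcess (P := P) hc hf hmin.measurable k
  -- Truncating `f⋆` makes the loss of the competitor below integrable, as minimality requires;
  -- letting `M` grow removes the truncation.
  have hM : ∀ M : ℕ, ∀ᵐ x ∂P.fst, |fstar x k| ≤ M → 0 ≤ marginalExcess P φ fstar f k x := by
    intro M
    set A : Set X := {x | marginalExcess P φ fstar f k x < 0 ∧ |fstar x k| ≤ M} with hA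
    have hAm : MeasurableSet A := (measurableSet_lt hme measurable_const).inter
      (measurableSet_le (measurable_score hmin.measurable k).abs measurable_const)
    -- The competitor changes `f⋆` only in coordinate `k`, and only where this would strictly lower
    -- the conditional risk.
    set g : Score X K := fun x j => if j = k ∧ x ∈ A then f x k else fstar x j with hg
    have hgm : Measurable g := by
      refine measurable_pi_iff.2 fun j => Measurable.ite ?_ (measurable_score hf k)
        (measurable_score hmin.measurable j)
      by_cases hj : j = k
      · simpa [hj] using hAm
      · simp [hj]
    obtain ⟨C, hC0, hC⟩ := exists_abs_le_of_continuous hc (max B M)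
    have hterm : ∀ (z : X × Fin K), |phiLoss φ g z - phiLoss φ fstar z| ≤ 2 * C := by
      intro z
      have : phiLoss φ g z - phiLoss φ fstar z =
          if z.1 ∈ A then φ (signedLabel z.2 k * f z.1 k) - φ (signedLabel z.2 k * fstar z.1 k)
          else 0 := by
        rw [phiLoss, phiLoss, ← Finset.sum_sub_distrib, Finset.sum_eq_single k]
        · by_cases hz : z.1 ∈ A <;> simp [hg, hz]
        · intro j _ hj; simp [hg, hj]
        · simp
      rw [this]
      split_ifs with hz
      · refine (abs_sub _ _).trans ?_
        have h1 := hC (signedLabel z.2 k * f z.1 k)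
          (by rw [abs_signedLabel_mul]; exact (hB _ _).trans (le_max_left _ _))
        have h2 := hC (signedLabel z.2 k * fstar z.1 k)
          (by rw [abs_signedLabel_mul]; exact hz.2.trans (le_max_right _ _))
        linarith
      · simpa using hC0
    have hdi : Integrable (fun z => phiLoss φ g z - phiLoss φ fstar z) P :=
      Integrable.of_bound ((measurable_phiLoss hc hgm).sub
        (measurable_phiLoss hc hmin.measurable)).aestronglyMeasurable _ (ae_of_all _ hterm)
    have hgi : Integrable (phiLoss φ g) P := by
      exact (hdi.add hmin.integrable).congr (ae_of_all _ fun z => by simp)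
    have hle := hmin.le g hgm hgi
    have hsum : ∀ x, ∑ j, marginalExcess P φ fstar g j x =
        A.indicator (marginalExcess P φ fstar f k) x := by
      intro x
      rw [Finset.sum_eq_single k]
      · by_cases hx : x ∈ A <;> simp [hg, hx, marginalExcess]
      · intro j _ hj; simp [hg, hj, marginalExcess]
      · simp
    have hint := integrable_sum_condProb hdi
    have heq := integral_eq_integral_sum_condProb hdi
    simp_rw [sum_condProb_mul_phiLoss_sub, hsum] at hint heq
    rw [integral_sub hgi hmin.integrable] at heq
    have hnp : 0 ≤ fun x => -A.indicator (marginalExcess P φ fstar f k) x := by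
      intro x
      simp only [Pi.zero_apply, Left.nonneg_neg_iff]
      exact indicator_nonpos (fun y hy => hy.1.le) x
    -- Minimality of `f⋆` makes the integral of this nonnegative function at most zero.
    have hz : ∫ x, -A.indicator (marginalExcess P φ fstar f k) x ∂P.fst = 0 := by
      refine le_antisymm ?_ (integral_nonneg hnp)
      rw [integral_neg, ← heq]
      unfold phiRisk at hle
      linarith
    have hae := (integral_eq_zero_iff_of_nonneg hnp hint.neg).1 hz
    filter_upwards [hae] with x hx hxM
    by_contra! hlt
    have hxA : x ∈ A := ⟨hlt, hxM⟩
    simp only [indicator_of_mem hxA, Pi.zero_apply] at hx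
    linarith
  filter_upwards [ae_all_iff.2 hM] with x hx
  obtain ⟨M, hM⟩ := exists_nat_ge |fstar x k|
  exact hx M hM

/-- Integrability of the loss only gives that of the sum over labels; almost sure nonnegativity lets
the sum dominate each term. -/
theorem integrable_marginalExcess (hφ : ConvexOn ℝ univ φ) (hmin : IsPhiMinimizer P φ fstar)
    (hf : Measurable f) {B : ℝ} (hB : ∀ x k, |f x k| ≤ B) (k : Fin K) :
    Integrable (marginalExcess P φ fstar f k) P.fst := by
  have hc := continuous_of_convexOn hφ
  have h := integrable_sum_condProb
    ((integrable_phiLoss (P := P) hc hf hB).sub hmin.integrable)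
  simp only [Pi.sub_apply, sum_condProb_mul_phiLoss_sub] at h
  refine h.mono' (measurable_marginalExcess hc hf hmin.measurable k).aestronglyMeasurable ?_
  filter_upwards [ae_all_iff.2 fun j => marginalExcess_nonneg_ae hφ hmin hf hB j] with x hx
  rw [Real.norm_eq_abs, abs_of_nonneg (hx k)]
  exact Finset.single_le_sum (f := fun j => marginalExcess P φ fstar f j x)
    (fun j _ => hx j) (Finset.mem_univ k)

theorem excessPhiRisk_eq_sum (hφ : ConvexOn ℝ univ φ) (hmin : IsPhiMinimizer P φ fstar)
    (hf : Measurable f) {B : ℝ} (hB : ∀ x k, |f x k| ≤ B) :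
    excessPhiRisk P φ fstar f = ∑ k, ∫ x, marginalExcess P φ fstar f k x ∂P.fst := by
  have hc := continuous_of_convexOn hφ
  have hi := integrable_phiLoss (P := P) hc hf hB
  rw [excessPhiRisk, phiRisk, phiRisk, ← integral_sub hi hmin.integrable,
    integral_eq_integral_sum_condProb (h := fun z => phiLoss φ f z - phiLoss φ fstar z)
      (hi.sub hmin.integrable)]
  simp_rw [sum_condProb_mul_phiLoss_sub]
  exact integral_finsetSum _ fun k _ => integrable_marginalExcess hφ hmin hf hB k

/-- The marginal conditional excess risk is nondecreasing on rays issued from the minimizer. -/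
theorem marginalExcess_const_le (hφ : ConvexOn ℝ univ φ) {k : Fin K} {x : X} {c : ℝ}
    (hc : c ∈ uIcc (fstar x k) (f x k)) (h0 : 0 ≤ marginalExcess P φ fstar f k x) :
    marginalExcess P φ fstar (fun _ _ => c) k x ≤ marginalExcess P φ fstar f k x := by
  set p := condProb P x k
  have hp0 : 0 ≤ p := condProb_nonneg x k
  have hp1 : 0 ≤ 1 - p := sub_nonneg.2 (condProb_le_one x k)
  have hneg : ConvexOn ℝ univ fun u => φ (-u) := by
    exact hφ.comp_linearMap (-LinearMap.id)
  have hψ : ConvexOn ℝ univ (fun u => p * φ u + (1 - p) * φ (-u)) := by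
    exact (hφ.smul hp0).add (hneg.smul hp1)
  -- On a segment a convex function is at most its larger endpoint value, which by `h0` is the one
  -- at `f x k`.
  have h := hψ.le_max_of_mem_segment (mem_univ _) (mem_univ _) (segment_eq_uIcc (𝕜 := ℝ) _ _ ▸ hc)
  simp only [marginalExcess] at h0 ⊢
  change 0 ≤ p * _ + (1 - p) * _ at h0
  change p * _ + (1 - p) * _ ≤ p * _ + (1 - p) * _
  rw [max_eq_right (by linarith)] at h
  linarith

end ConditionalRisk

/-! ### From excess `φ`-risk to the distance from the oracle set -/

section Comparison

/-- The margin condition says nothing about points where `p_k` equals the threshold; absence of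
atoms makes them negligible. -/
theorem measureReal_score_eq {X : Type*} [MeasurableSpace X] {K : ℕ} {μ : Measure X}
    [IsFiniteMeasure μ] {f : Score X K} (hf : Measurable f) {k : Fin K}
    (hc : Continuous (scoreCDF μ f k)) (t : ℝ) : μ.real {x | f x k = t} = 0 := by
  refine le_antisymm ?_ measureReal_nonneg
  have h : Tendsto (scoreCDF μ f k) (𝓝[<] t) (𝓝 (scoreCDF μ f k t)) :=
    (hc.tendsto t).mono_left nhdsWithin_le_nhds
  have hle : scoreCDF μ f k t ≤ scoreCDF μ f k t - μ.real {x | f x k = t} := by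
    refine le_of_tendsto h ?_
    filter_upwards [self_mem_nhdsWithin] with s hs
    have hd : Disjoint {x | f x k ≤ s} {x | f x k = t} := by
      rw [Set.disjoint_left]
      intro x hx hx'
      exact absurd hs (not_lt.2 (hx'.symm.le.trans hx))
    have hu := measureReal_union (μ := μ) hd
      (measurableSet_eq_fun (measurable_score hf k) measurable_const)
    have hm : μ.real ({x | f x k ≤ s} ∪ {x | f x k = t}) ≤ scoreCDF μ f k t := by
      refine measureReal_mono (union_subset (fun x hx => ?_) fun x hx => ?_)
      · exact le_trans hx (le_of_lt (mem_Iio.1 hs))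
      · exact le_of_eq hx
    unfold scoreCDF at *
    linarith
  linarith

theorem abs_risk_sub_risk_le {X : Type*} [MeasurableSpace X] {K : ℕ}
    {P : Measure (X × Fin K)} [IsFiniteMeasure P] (Γ₁ Γ₂ : LabelSet X K) :
    |risk P Γ₁ - risk P Γ₂| ≤ ∑ k, P.fst.real {x | ¬ (k ∈ Γ₁ x ↔ k ∈ Γ₂ x)} := by
  have hle : ∀ Γ₁ Γ₂ : LabelSet X K,
      risk P Γ₁ - risk P Γ₂ ≤ ∑ k, P.fst.real {x | ¬ (k ∈ Γ₁ x ↔ k ∈ Γ₂ x)} := by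
    intro Γ₁ Γ₂
    have hsub : {z : X × Fin K | z.2 ∉ Γ₁ z.1} ⊆ {z | z.2 ∉ Γ₂ z.1} ∪
        ⋃ k ∈ (Finset.univ : Finset (Fin K)), Prod.fst ⁻¹' {x | ¬ (k ∈ Γ₁ x ↔ k ∈ Γ₂ x)} := by
      intro z hz
      by_cases h : z.2 ∈ Γ₂ z.1
      · right
        simp only [mem_iUnion]
        exact ⟨z.2, Finset.mem_univ _, fun h' => hz (h'.2 h)⟩
      · exact Or.inl h
    have h1 := measureReal_mono (μ := P) hsub
    have h2 := measureReal_union_le (μ := P) {z : X × Fin K | z.2 ∉ Γ₂ z.1}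
      (⋃ k ∈ (Finset.univ : Finset (Fin K)), Prod.fst ⁻¹' {x | ¬ (k ∈ Γ₁ x ↔ k ∈ Γ₂ x)})
    have h3 := measureReal_biUnion_finset_le (μ := P) (Finset.univ : Finset (Fin K))
      fun k => Prod.fst ⁻¹' {x | ¬ (k ∈ Γ₁ x ↔ k ∈ Γ₂ x)}
    -- The confidence sets are arbitrary, so measurability is unavailable; this inequality holds for
    -- every set.
    have h4 : ∀ s : Set X, P.real (Prod.fst ⁻¹' s) ≤ P.fst.real s := fun s =>
      ENNReal.toReal_mono (measure_ne_top _ _)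
        (Measure.le_map_apply measurable_fst.aemeasurable s)
    have h5 := Finset.sum_le_sum fun k (_ : k ∈ (Finset.univ : Finset (Fin K))) =>
      h4 {x | ¬ (k ∈ Γ₁ x ↔ k ∈ Γ₂ x)}
    unfold risk
    linarith
  refine abs_sub_le_iff.2 ⟨hle Γ₁ Γ₂, (hle Γ₂ Γ₁).trans (le_of_eq ?_)⟩
  simp_rw [iff_comm]

variable {X : Type*} [MeasurableSpace X] {K : ℕ} [NeZero K]
  {P : Measure (X × Fin K)} [IsProbabilityMeasure P] {φ : ℝ → ℝ} {f fstar : Score X K}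
  {β δ α s c₂ C₀ r B : ℝ}

/-- Points of `A k` within `t` of the threshold are counted by the margin condition. At the others
the marginal excess of `f` is at least `t^s / C₀`, so Markov's inequality bounds their mass by the
excess risk. -/
theorem sum_measureReal_le_of_between (hα : 0 < α) (hs : 0 < s) (hC₀ : 0 < C₀)
    (hr : 0 < r) (hcp : ∀ k, Continuous (scoreCDF P.fst (condProb P) k))
    (hφ : ConvexOn ℝ univ φ) (hmin : IsPhiMinimizer P φ fstar)
    (hcal : ∀ k, ∀ᵐ x ∂P.fst, |condProb P x k - oracleGInv P β| ^ s ≤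
        C₀ * marginalExcess P φ fstar (fun _ _ => -δ) k x)
    (hmargin : ∀ k, MarginCondition P β α c₂ k)
    (hf : Measurable f) (hB : ∀ x k, |f x k| ≤ B) (hfr : excessPhiRisk P φ fstar f ≤ r)
    {A : Fin K → Set X} (hA : ∀ k, MeasurableSet (A k))
    (hAδ : ∀ k, ∀ᵐ x ∂P.fst, x ∈ A k → -δ ∈ uIcc (fstar x k) (f x k)) :
    ∑ k, P.fst.real (A k) ≤ (c₂ + C₀) * (K * (r / K) ^ (α / (α + s))) := by
  have hK : (0 : ℝ) < K := by exact_mod_cast Nat.pos_of_ne_zero (NeZero.ne K)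
  set q := r / K with hq
  have hq0 : 0 < q := by positivity
  have hαs : 0 < α + s := by positivity
  -- This choice equates the orders `K t^α` of the near part and `r / t^s` of the far part.
  set t := q ^ (1 / (α + s)) with ht
  have ht0 : 0 < t := by positivity
  have htα : t ^ α = q ^ (α / (α + s)) := by
    rw [ht, ← Real.rpow_mul hq0.le]; congr 1; field_simp
  have hts : q ^ (α / (α + s)) * t ^ s = q := by
    rw [ht, ← Real.rpow_mul hq0.le, ← Real.rpow_add hq0]
    conv_rhs => rw [← Real.rpow_one q]
    congr 1
    field_simp
  set θ := oracleGInv P β with hθ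
  set far : Fin K → Set X := fun k => A k ∩ {x | t < |condProb P x k - θ|} with hfar
  have hpm := fun k => measurable_condProb_apply (P := P) k
  have hfarm : ∀ k, MeasurableSet (far k) := fun k =>
    (hA k).inter (measurableSet_lt measurable_const ((hpm k).sub_const θ).abs)
  have hsplit : ∀ k, P.fst.real (A k) ≤ c₂ * t ^ α + P.fst.real (far k) := by
    intro k
    have hsub : A k ⊆ ({x | 0 < |condProb P x k - θ| ∧ |condProb P x k - θ| ≤ t} ∪
        {x | condProb P x k = θ}) ∪ far k := by
      intro x hx
      rcases le_or_gt |condProb P x k - θ| t with h | h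
      · rcases (abs_nonneg (condProb P x k - θ)).eq_or_lt with h0 | h0
        · exact Or.inl (Or.inr (sub_eq_zero.1 (abs_eq_zero.1 h0.symm)))
        · exact Or.inl (Or.inl ⟨h0, h⟩)
      · exact Or.inr ⟨hx, h⟩
    have h1 := measureReal_mono (μ := P.fst) hsub
    have h2 := measureReal_union_le (μ := P.fst)
      ({x | 0 < |condProb P x k - θ| ∧ |condProb P x k - θ| ≤ t} ∪ {x | condProb P x k = θ}) (far k)
    have h3 := measureReal_union_le (μ := P.fst)
      {x | 0 < |condProb P x k - θ| ∧ |condProb P x k - θ| ≤ t} {x | condProb P x k = θ}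
    have h4 := hmargin k t ht0
    have h5 := measureReal_score_eq (measurable_condProb (P := P)) (hcp k) θ
    linarith
  have hfar_le : ∀ k, P.fst.real (far k) * t ^ s ≤
      C₀ * ∫ x, marginalExcess P φ fstar f k x ∂P.fst := by
    intro k
    rw [← smul_eq_mul, ← integral_indicator_const _ (hfarm k), ← integral_const_mul]
    refine integral_mono_ae ((integrable_const _).indicator (hfarm k))
      ((integrable_marginalExcess hφ hmin hf hB k).const_mul C₀) ?_
    filter_upwards [hcal k, hAδ k, marginalExcess_nonneg_ae hφ hmin hf hB k] with x h1 h2 h3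
    refine indicator_apply_le' (fun hx => ?_) fun _ => by positivity
    calc t ^ s ≤ |condProb P x k - θ| ^ s := Real.rpow_le_rpow ht0.le (le_of_lt hx.2) hs.le
      _ ≤ _ := h1
      _ ≤ _ := mul_le_mul_of_nonneg_left (marginalExcess_const_le hφ (h2 hx.1) h3) hC₀.le
  have hfar_sum : ∑ k, P.fst.real (far k) ≤ C₀ * (K * q ^ (α / (α + s))) := by
    have hts0 : 0 < t ^ s := by positivity
    refine le_of_mul_le_mul_right ?_ hts0
    calc (∑ k, P.fst.real (far k)) * t ^ s
        ≤ C₀ * ∑ k, ∫ x, marginalExcess P φ fstar f k x ∂P.fst := by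
          rw [Finset.sum_mul, Finset.mul_sum]
          exact Finset.sum_le_sum fun k _ => hfar_le k
      _ ≤ C₀ * r := by
          rw [← excessPhiRisk_eq_sum hφ hmin hf hB]; gcongr
      _ = C₀ * (K * q ^ (α / (α + s))) * t ^ s := by
          rw [mul_assoc, mul_assoc, hts, hq]; field_simp
  calc ∑ k, P.fst.real (A k) ≤ ∑ k : Fin K, (c₂ * t ^ α + P.fst.real (far k)) :=
        Finset.sum_le_sum fun k _ => hsplit k
    _ = c₂ * (K * q ^ (α / (α + s))) + ∑ k, P.fst.real (far k) := by
        rw [Finset.sum_add_distrib, htα]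
        simp
        ring
    _ ≤ _ := by linarith

/-- The size of the symmetric difference of the level set of a score and of the oracle set is
controlled by the excess `φ`-risk of the score. -/
theorem sum_measureReal_levelSet_symmDiff_le (hα : 0 < α) (hs : 0 < s) (hC₀ : 0 < C₀)
    (hr : 0 < r) (hβ : β ∈ Ioo (0 : ℝ) K)
    (hcp : ∀ k, Continuous (scoreCDF P.fst (condProb P) k))
    (hφ : ConvexOn ℝ univ φ) (hmin : IsPhiMinimizer P φ fstar)
    (hδ : ∀ᵐ x ∂P.fst, thresholdSet fstar δ x = oracleSet P β x)
    (hcal : ∀ k, ∀ᵐ x ∂P.fst, |condProb P x k - oracleGInv P β| ^ s ≤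
        C₀ * marginalExcess P φ fstar (fun _ _ => -δ) k x)
    (hmargin : ∀ k, MarginCondition P β α c₂ k)
    (hf : Measurable f) (hB : ∀ x k, |f x k| ≤ B) (hfr : excessPhiRisk P φ fstar f ≤ r)
    (hcf : ∀ k, Continuous (scoreCDF P.fst f k)) :
    ∑ k, P.fst.real {x | ¬ (k ∈ levelSet P.fst f β x ↔ k ∈ oracleSet P β x)} ≤
      2 * (c₂ + C₀) * (K * (r / K) ^ (α / (α + s))) := by
  obtain ⟨t₀, ht₀, hsum₀⟩ := levelSet_eq_threshold hf hcf hβ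
  obtain ⟨t₁, ht₁, hsum₁⟩ := levelSet_eq_threshold (measurable_condProb (P := P)) hcp hβ
  set S : Fin K → Set X := fun k => {x | t₀ ≤ f x k} with hS
  set O : Fin K → Set X := fun k => {x | t₁ ≤ condProb P x k} with hO
  have hSm : ∀ k, MeasurableSet (S k) := fun k =>
    measurableSet_le measurable_const (measurable_score hf k)
  have hOm : ∀ k, MeasurableSet (O k) := fun k =>
    measurableSet_le measurable_const (measurable_condProb_apply k)
  have hOδ : ∀ᵐ x ∂P.fst, ∀ k, x ∈ O k ↔ -δ ≤ fstar x k := by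
    filter_upwards [hδ] with x hx k
    have h1 := Set.ext_iff.1 hx k
    exact (ht₁ x k).symm.trans h1.symm
  have hsymm : ∀ k, P.fst.real {x | ¬ (k ∈ levelSet P.fst f β x ↔ k ∈ oracleSet P β x)} ≤
      P.fst.real (S k \ O k) + P.fst.real (O k \ S k) := by
    intro k
    refine (measureReal_mono fun x hx => ?_).trans (measureReal_union_le _ _)
    have h1 := ht₀ x k
    have h2 : k ∈ oracleSet P β x ↔ x ∈ O k := ht₁ x k
    have hx' : ¬ (x ∈ S k ↔ x ∈ O k) := by
      rw [← h2]; exact fun h => hx (h1.trans h)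
    simp only [mem_union, Set.mem_sdiff]
    tauto
  -- Both differences of masses sum to `β - β`.
  have hsize : ∑ k, P.fst.real (S k \ O k) = ∑ k, P.fst.real (O k \ S k) := by
    have h : ∀ k, P.fst.real (S k \ O k) - P.fst.real (O k \ S k) =
        P.fst.real (S k) - P.fst.real (O k) := by
      intro k
      have h1 := measureReal_inter_add_sdiff (μ := P.fst) (s := S k) (hOm k)
      have h2 := measureReal_inter_add_sdiff (μ := P.fst) (s := O k) (hSm k)
      rw [inter_comm] at h2
      linarith
    have h' := Finset.sum_congr (rfl : (Finset.univ : Finset (Fin K)) = _) fun k _ => h k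
    rw [Finset.sum_sub_distrib, Finset.sum_sub_distrib, hsum₀, hsum₁] at h'
    linarith
  have hkey := fun (A : Fin K → Set X) => sum_measureReal_le_of_between (A := A) hα hs hC₀ hr hcp
    hφ hmin hcal hmargin hf hB hfr
  have hone : ∑ k, P.fst.real (S k \ O k) ≤ (c₂ + C₀) * (K * (r / K) ^ (α / (α + s))) := by
    -- If `-δ ≤ t₀`, then `f⋆_k < -δ ≤ t₀ ≤ f_k` on `S k \ O k`; otherwise `f_k < t₀ < -δ ≤ f⋆_k` on
    -- `O k \ S k`, which has the same total mass.
    rcases le_or_gt (-δ) t₀ with h | h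
    · refine hkey _ (fun k => (hSm k).diff (hOm k)) fun k => ?_
      filter_upwards [hOδ] with x hx hxA
      have h1 : ¬ -δ ≤ fstar x k := fun h' => hxA.2 ((hx k).2 h')
      exact mem_uIcc.2 (Or.inl ⟨(not_le.1 h1).le, h.trans hxA.1⟩)
    · rw [hsize]
      refine hkey _ (fun k => (hOm k).diff (hSm k)) fun k => ?_
      filter_upwards [hOδ] with x hx hxA
      have h1 : f x k < t₀ := not_le.1 hxA.2
      exact mem_uIcc.2 (Or.inr ⟨(h1.trans h).le, (hx k).1 hxA.1⟩)
  calc _ ≤ ∑ k, (P.fst.real (S k \ O k) + P.fst.real (O k \ S k)) :=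
        Finset.sum_le_sum fun k _ => hsymm k
    _ = 2 * ∑ k, P.fst.real (S k \ O k) := by rw [Finset.sum_add_distrib, ← hsize]; ring
    _ ≤ _ := by linarith

end Comparison

/-! ### Finite nets inside the class -/

section Net

/-- Doubling the radius moves the centers into `F`, where the uniform bound and the modulus of
convexity apply. -/
theorem exists_finset_net {X : Type*} {K : ℕ} {F : Set (Score X K)} {r : ℝ≥0}
    (h : supCoveringNumber r F ≠ ⊤) :
    ∃ T : Finset (Score X K), ↑T ⊆ F ∧ T.card ≤ (supCoveringNumber r F).toNat ∧
      ∀ f ∈ F, ∃ g ∈ T, ∀ x k, |f x k - g x k| ≤ 2 * r := by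
  classical
  set A : Set (X →ᵤ (Fin K → ℝ)) := UniformFun.ofFun '' F with hA
  have hle : Metric.coveringNumber (2 * r) A ≤ supCoveringNumber r F :=
    Metric.coveringNumber_two_mul_le_externalCoveringNumber r A
  have hne : Metric.coveringNumber (2 * r) A ≠ ⊤ := ne_top_of_le_ne_top h hle
  obtain ⟨C, hCA, hCfin, hC, hcard⟩ := Metric.exists_set_encard_eq_coveringNumber hne
  have hCfin' : (UniformFun.toFun '' C).Finite := hCfin.image _
  refine ⟨hCfin'.toFinset, ?_, ?_, ?_⟩
  · rw [hCfin'.coe_toFinset]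
    rintro _ ⟨c, hc, rfl⟩
    obtain ⟨f, hf, rfl⟩ := hCA hc
    exact hf
  · have h1 : ((hCfin'.toFinset.card : ℕ) : ℕ∞) ≤ supCoveringNumber r F := by
      rw [← Set.encard_coe_eq_coe_finsetCard, hCfin'.coe_toFinset]
      exact (Set.encard_image_le _ _).trans (hcard.le.trans hle)
    rw [← ENat.natCast_toNat h] at h1
    exact_mod_cast h1
  · intro f hf
    obtain ⟨c, hc, hfc⟩ := hC (mem_image_of_mem _ hf)
    refine ⟨UniformFun.toFun c, hCfin'.mem_toFinset.2 (mem_image_of_mem _ hc), fun x k => ?_⟩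
    have h1 := (UniformFun.edist_le.1 hfc) x
    have h2 := (edist_pi_le_iff.1 h1) k
    rw [edist_nndist, ENNReal.coe_le_coe, ← NNReal.coe_le_coe, coe_nndist, Real.dist_eq] at h2
    simpa using h2

end Net

/-! ### Exponential moments -/

section Exponential

variable {Z : Type*} [MeasurableSpace Z] {P : Measure Z} [IsProbabilityMeasure P]

/-- From `e^x ≤ 1 + x + x²` on `|x| ≤ 1`, with `x = -2lD`, and then `1 + y ≤ e^y`. The factor two on
`D` leaves the drift `-l ∫ D`, which later absorbs the variance term. -/
theorem integral_exp_le {D : Z → ℝ} (hD : Measurable D) {b l : ℝ} (hb : ∀ z, |D z| ≤ b)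
    (hl : 0 ≤ l) (hlb : 2 * l * b ≤ 1) :
    ∫ z, Real.exp (l * (∫ z, D z ∂P - 2 * D z)) ∂P ≤
      Real.exp (-(l * ∫ z, D z ∂P) + 4 * l ^ 2 * ∫ z, D z ^ 2 ∂P) := by
  set m := ∫ z, D z ∂P with hm
  have hDi : Integrable D P := Integrable.of_bound hD.aestronglyMeasurable b (ae_of_all _ hb)
  have hD2i : Integrable (fun z => D z ^ 2) P :=
    Integrable.of_bound (hD.pow_const 2).aestronglyMeasurable (b ^ 2) (ae_of_all _ fun z => by
      rw [Real.norm_eq_abs, abs_pow]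
      exact pow_le_pow_left₀ (abs_nonneg _) (hb z) 2)
  have hpt : ∀ z, Real.exp (l * (m - 2 * D z)) ≤
      Real.exp (l * m) * (1 + (-(2 * l) * D z + 4 * l ^ 2 * D z ^ 2)) := by
    intro z
    have hx : |-(2 * l) * D z| ≤ 1 := by
      rw [abs_mul, abs_neg, abs_of_nonneg (by positivity)]
      exact (mul_le_mul_of_nonneg_left (hb z) (by positivity)).trans hlb
    have h1 := (abs_le.1 (Real.abs_exp_sub_one_sub_id_le hx)).2
    have h2 : Real.exp (l * (m - 2 * D z)) = Real.exp (l * m) * Real.exp (-(2 * l) * D z) := by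
      rw [← Real.exp_add]; congr 1; ring
    rw [h2]
    refine mul_le_mul_of_nonneg_left ?_ (Real.exp_pos _).le
    linarith [h1]
  have hint : Integrable (fun z => -(2 * l) * D z + 4 * l ^ 2 * D z ^ 2) P :=
    (hDi.const_mul _).add (hD2i.const_mul _)
  calc ∫ z, Real.exp (l * (m - 2 * D z)) ∂P
      ≤ ∫ z, Real.exp (l * m) * (1 + (-(2 * l) * D z + 4 * l ^ 2 * D z ^ 2)) ∂P :=
        integral_mono_of_nonneg (ae_of_all _ fun z => (Real.exp_pos _).le)
          (((integrable_const _).add hint).const_mul _) (ae_of_all _ hpt)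
    _ = Real.exp (l * m) * (1 + (-(2 * l) * m + 4 * l ^ 2 * ∫ z, D z ^ 2 ∂P)) := by
        rw [integral_const_mul, integral_add (integrable_const _) hint,
          integral_add (hDi.const_mul _) (hD2i.const_mul _), integral_const_mul,
          integral_const_mul]
        simp [hm]
    _ ≤ Real.exp (l * m) * Real.exp (-(2 * l) * m + 4 * l ^ 2 * ∫ z, D z ^ 2 ∂P) := by
        refine mul_le_mul_of_nonneg_left ?_ (Real.exp_pos _).le
        linarith [Real.add_one_le_exp (-(2 * l) * m + 4 * l ^ 2 * ∫ z, D z ^ 2 ∂P)]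
    _ = _ := by rw [← Real.exp_add]; congr 1; ring

theorem integral_exp_sum_le {D : Z → ℝ} (hD : Measurable D) {b l : ℝ} (hb : ∀ z, |D z| ≤ b)
    (hl : 0 ≤ l) (hlb : 2 * l * b ≤ 1) (n : ℕ) :
    ∫ d, Real.exp (l * (n * ∫ z, D z ∂P - 2 * ∑ i, D (d i))) ∂Measure.pi (fun _ : Fin n => P) ≤
      Real.exp (n * (-(l * ∫ z, D z ∂P) + 4 * l ^ 2 * ∫ z, D z ^ 2 ∂P)) := by
  have heq : ∀ d : Fin n → Z, Real.exp (l * (n * ∫ z, D z ∂P - 2 * ∑ i, D (d i))) =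
      ∏ i, Real.exp (l * (∫ z, D z ∂P - 2 * D (d i))) := by
    intro d
    rw [← Real.exp_sum, ← Finset.mul_sum, Finset.sum_sub_distrib, ← Finset.mul_sum]
    simp
  simp_rw [heq]
  rw [integral_fintype_prod_eq_prod (μ := fun _ : Fin n => P)
    (fun _ z => Real.exp (l * (∫ z, D z ∂P - 2 * D z)))]
  rw [Finset.prod_const, Finset.card_univ, Fintype.card_fin, Real.exp_nat_mul]
  exact pow_le_pow_left₀ (integral_nonneg fun z => (Real.exp_pos _).le)
    (integral_exp_le hD hb hl hlb) n

/-- Jensen's inequality, obtained from the tangent line of the exponential at `c`. -/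
theorem integral_le_log_of_integral_exp_le {W : Z → ℝ} (hW : Integrable W P)
    (hexp : Integrable (fun z => Real.exp (W z)) P) {c : ℝ}
    (h : ∫ z, Real.exp (W z) ∂P ≤ Real.exp c) : ∫ z, W z ∂P ≤ c := by
  have hpt : ∀ z, W z ≤ Real.exp (W z) * Real.exp (-c) + (c - 1) := by
    intro z
    have := Real.add_one_le_exp (W z - c)
    rw [sub_eq_add_neg, Real.exp_add] at this
    linarith
  have h1 := integral_mono hW ((hexp.mul_const _).add (integrable_const (c - 1))) hpt
  simp only [Pi.add_apply] at h1
  rw [integral_add (hexp.mul_const _) (integrable_const _), integral_mul_const] at h1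
  have h2 : (∫ z, Real.exp (W z) ∂P) * Real.exp (-c) ≤ 1 := by
    calc _ ≤ Real.exp c * Real.exp (-c) :=
          mul_le_mul_of_nonneg_right h (Real.exp_pos _).le
      _ = 1 := by rw [← Real.exp_add]; simp
  simp only [integral_const, probReal_univ, smul_eq_mul, one_mul] at h1
  linarith

end Exponential

/-! ### Lipschitz bounds for loss increments -/

section LossIncrements

variable {X : Type*} {K : ℕ} {φ : ℝ → ℝ} {f g : Score X K} {B : ℝ} {L : ℝ≥0}

theorem abs_phiLoss_sub_le (hL : LipschitzOnWith L φ (Icc (-B) B))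
    (hf : ∀ x k, |f x k| ≤ B) (hg : ∀ x k, |g x k| ≤ B) (z : X × Fin K) :
    |phiLoss φ f z - phiLoss φ g z| ≤ L * ∑ k, |f z.1 k - g z.1 k| := by
  rw [phiLoss, phiLoss, ← Finset.sum_sub_distrib, Finset.mul_sum]
  refine (Finset.abs_sum_le_sum_abs _ _).trans (Finset.sum_le_sum fun k _ => ?_)
  have h := hL.dist_le_mul (signedLabel z.2 k * f z.1 k)
    (abs_le.1 (by rw [abs_signedLabel_mul]; exact hf _ _)) (signedLabel z.2 k * g z.1 k)
    (abs_le.1 (by rw [abs_signedLabel_mul]; exact hg _ _))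
  rwa [Real.dist_eq, Real.dist_eq, ← mul_sub, abs_signedLabel_mul] at h

theorem abs_phiLoss_sub_le_of_forall_le (hL : LipschitzOnWith L φ (Icc (-B) B))
    (hf : ∀ x k, |f x k| ≤ B) (hg : ∀ x k, |g x k| ≤ B) {c : ℝ}
    (hc : ∀ x k, |f x k - g x k| ≤ c) (z : X × Fin K) :
    |phiLoss φ f z - phiLoss φ g z| ≤ L * (K * c) := by
  refine (abs_phiLoss_sub_le hL hf hg z).trans ?_
  gcongr
  exact (Finset.sum_le_sum fun k _ => hc z.1 k).trans (by simp)

theorem abs_phiLoss_sub_le_bound (hL : LipschitzOnWith L φ (Icc (-B) B))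
    (hf : ∀ x k, |f x k| ≤ B) (hg : ∀ x k, |g x k| ≤ B) (z : X × Fin K) :
    |phiLoss φ f z - phiLoss φ g z| ≤ L * (K * (2 * B)) :=
  abs_phiLoss_sub_le_of_forall_le hL hf hg
    (fun x k => (abs_sub _ _).trans (by linarith [hf x k, hg x k])) z

theorem phiLoss_sub_sq_le (hL : LipschitzOnWith L φ (Icc (-B) B))
    (hf : ∀ x k, |f x k| ≤ B) (hg : ∀ x k, |g x k| ≤ B) (z : X × Fin K) :
    (phiLoss φ f z - phiLoss φ g z) ^ 2 ≤ L ^ 2 * K * ∑ k, (f z.1 k - g z.1 k) ^ 2 := by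
  have h1 := abs_phiLoss_sub_le hL hf hg z
  have h2 := sq_sum_le_card_mul_sum_sq (s := (Finset.univ : Finset (Fin K)))
    (f := fun k => |f z.1 k - g z.1 k|)
  simp only [sq_abs, Finset.card_univ, Fintype.card_fin] at h2
  calc (phiLoss φ f z - phiLoss φ g z) ^ 2 = |phiLoss φ f z - phiLoss φ g z| ^ 2 := (sq_abs _).symm
    _ ≤ (L * ∑ k, |f z.1 k - g z.1 k|) ^ 2 := pow_le_pow_left₀ (abs_nonneg _) h1 2
    _ = L ^ 2 * (∑ k, |f z.1 k - g z.1 k|) ^ 2 := mul_pow _ _ _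
    _ ≤ L ^ 2 * (K * ∑ k, (f z.1 k - g z.1 k) ^ 2) := by gcongr
    _ = _ := by ring

variable [MeasurableSpace X] {P : Measure (X × Fin K)} [IsProbabilityMeasure P]

theorem integral_phiLoss_sub_sq_le (hL : LipschitzOnWith L φ (Icc (-B) B))
    (hfm : Measurable f) (hgm : Measurable g)
    (hf : ∀ x k, |f x k| ≤ B) (hg : ∀ x k, |g x k| ≤ B) :
    ∫ z, (phiLoss φ f z - phiLoss φ g z) ^ 2 ∂P ≤
      L ^ 2 * K * ∑ k, ∫ x, (f x k - g x k) ^ 2 ∂P.fst := by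
  have hm : ∀ k, Measurable fun x => (f x k - g x k) ^ 2 := fun k =>
    ((measurable_score hfm k).sub (measurable_score hgm k)).pow_const 2
  have hi : ∀ k, Integrable (fun x => (f x k - g x k) ^ 2) P.fst := fun k =>
    Integrable.of_bound (hm k).aestronglyMeasurable ((2 * B) ^ 2) (ae_of_all _ fun x => by
      rw [Real.norm_eq_abs, abs_pow]
      exact pow_le_pow_left₀ (abs_nonneg _)
        ((abs_sub _ _).trans (by linarith [hf x k, hg x k])) 2)
  have hi' : ∀ k, Integrable (fun z : X × Fin K => (f z.1 k - g z.1 k) ^ 2) P := fun k =>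
    (hi k).comp_measurable measurable_fst
  have hmap : ∀ k, ∫ x, (f x k - g x k) ^ 2 ∂P.fst = ∫ z, (f z.1 k - g z.1 k) ^ 2 ∂P := fun k =>
    integral_map measurable_fst.aemeasurable (hm k).aestronglyMeasurable
  simp_rw [hmap]
  rw [← integral_finsetSum _ fun k _ => hi' k, ← integral_const_mul]
  exact integral_mono_of_nonneg (ae_of_all _ fun z => sq_nonneg _)
    ((integrable_finsetSum _ fun k _ => hi' k).const_mul _)
    (ae_of_all _ fun z => phiLoss_sub_sq_le hL hf hg z)

end LossIncrements

/-! ### Fast rate for empirical risk minimization -/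

section ERM

variable {X : Type*} [MeasurableSpace X] {K : ℕ}
  {P : Measure (X × Fin K)} {φ : ℝ → ℝ} {fstar : Score X K}
  {F : Set (Score X K)} {B c₁ : ℝ} {L : ℝ≥0} {n : ℕ}

/-- The midpoint of `f` and `g` stays in the class, so its excess is at least `ρ`; the modulus at
`ε² = S` then gives the bound. This is the Bernstein-type condition behind the fast rate. -/
theorem two_mul_sum_integral_sq_le (hF : Convex ℝ F)
    (hmod : ∀ ε : ℝ, 0 < ε → ((c₁ * ε ^ 2 : ℝ) : EReal) ≤ convexityModulus P φ F ε)
    {ρ : ℝ} (hρ : ∀ f ∈ F, ρ ≤ excessPhiRisk P φ fstar f) {f g : Score X K} (hf : f ∈ F)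
    (hg : g ∈ F) :
    2 * c₁ * ∑ k, ∫ x, (f x k - g x k) ^ 2 ∂P.fst ≤
      (excessPhiRisk P φ fstar f - ρ) + (excessPhiRisk P φ fstar g - ρ) := by
  set S := ∑ k, ∫ x, (f x k - g x k) ^ 2 ∂P.fst with hS
  have hS0 : 0 ≤ S := Finset.sum_nonneg fun k _ => integral_nonneg fun x => sq_nonneg _
  rcases hS0.eq_or_lt with h0 | h0
  · rw [← h0]
    linarith [hρ f hf, hρ g hg]
  · have h1 := hmod (√S) (Real.sqrt_pos.2 h0)
    rw [Real.sq_sqrt hS0] at h1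
    have h2 : ((c₁ * S : ℝ) : EReal) ≤ (((phiRisk P φ f + phiRisk P φ g) / 2 -
        phiRisk P φ ((1 / 2 : ℝ) • (f + g)) : ℝ) : EReal) := by
      refine h1.trans ?_
      unfold convexityModulus
      refine (iInf₂_le f hf).trans ((iInf₂_le g hg).trans (iInf_le _ ?_))
      rw [Real.sq_sqrt hS0]
    have h3 := EReal.coe_le_coe_iff.1 h2
    have hmid : (1 / 2 : ℝ) • (f + g) ∈ F := by
      rw [smul_add]
      exact hF hf hg (by norm_num) (by norm_num) (by norm_num)
    have h4 := hρ _ hmid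
    unfold excessPhiRisk at *
    linarith

variable [IsProbabilityMeasure P]

/-- The Bernstein-type condition bounds the second moment of the increment by a multiple of `K (m +
2η)`. For `l` of order `1/K` the variance term is at most `l (m + 2η)`, and the drift `-l m` cancels
all but `2lη`. -/
theorem integral_exp_excess_sub_le (hφ : Continuous φ) (hL : LipschitzOnWith L φ (Icc (-B) B))
    (hc₁ : 0 < c₁) (hF : Convex ℝ F) (hFm : ∀ f ∈ F, Measurable f)
    (hFB : ∀ f ∈ F, ∀ x k, |f x k| ≤ B)
    (hmod : ∀ ε : ℝ, 0 < ε → ((c₁ * ε ^ 2 : ℝ) : EReal) ≤ convexityModulus P φ F ε)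
    {ρ η : ℝ} (hρ : ∀ f ∈ F, ρ ≤ excessPhiRisk P φ fstar f) {f g : Score X K} (hf : f ∈ F)
    (hg : g ∈ F) (hgη : excessPhiRisk P φ fstar g ≤ ρ + η) (hη : 0 ≤ η) {l : ℝ} (hl : 0 ≤ l)
    (hlB : l * (4 * B * L * K) ≤ 1) (hlc : l * (2 * L ^ 2 / c₁ * K) ≤ 1) :
    ∫ d, Real.exp (l * (n * (excessPhiRisk P φ fstar f - excessPhiRisk P φ fstar g) -
        2 * ∑ i, (phiLoss φ f (d i) - phiLoss φ g (d i)))) ∂Measure.pi (fun _ : Fin n => P) ≤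
      Real.exp (n * (2 * l * η)) := by
  have hfi := integrable_phiLoss (P := P) hφ (hFm f hf) (hFB f hf)
  have hgi := integrable_phiLoss (P := P) hφ (hFm g hg) (hFB g hg)
  have hm : ∫ z, (phiLoss φ f z - phiLoss φ g z) ∂P =
      excessPhiRisk P φ fstar f - excessPhiRisk P φ fstar g := by
    rw [integral_sub hfi hgi]; unfold excessPhiRisk phiRisk; ring
  have h := integral_exp_sum_le (P := P) (D := fun z => phiLoss φ f z - phiLoss φ g z)
    ((measurable_phiLoss hφ (hFm f hf)).sub (measurable_phiLoss hφ (hFm g hg)))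
    (abs_phiLoss_sub_le_bound hL (hFB f hf) (hFB g hg)) hl (by linarith) n
  rw [hm] at h
  refine h.trans (Real.exp_le_exp.2 (mul_le_mul_of_nonneg_left ?_ (Nat.cast_nonneg n)))
  have hsq := integral_phiLoss_sub_sq_le (P := P) hL (hFm f hf) (hFm g hg) (hFB f hf) (hFB g hg)
  have hS := two_mul_sum_integral_sq_le hF hmod hρ hf hg
  have hfρ := hρ f hf
  set S := ∑ k, ∫ x, (f x k - g x k) ^ 2 ∂P.fst
  set m := excessPhiRisk P φ fstar f - excessPhiRisk P φ fstar g with hmdef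
  set V := ∫ z, (phiLoss φ f z - phiLoss φ g z) ^ 2 ∂P
  have hm2 : 0 ≤ m + 2 * η := by linarith
  have hS' : 2 * c₁ * S ≤ m + 2 * η := by linarith
  have hV : 4 * l ^ 2 * V ≤ l * (m + 2 * η) := by
    calc 4 * l ^ 2 * V ≤ 4 * l ^ 2 * (L ^ 2 * K * S) := by gcongr
      _ = l * (l * (2 * L ^ 2 / c₁ * K)) * (2 * c₁ * S) := by field_simp; ring
      _ ≤ l * (l * (2 * L ^ 2 / c₁ * K)) * (m + 2 * η) := by gcongr
      _ ≤ l * 1 * (m + 2 * η) := by gcongr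
      _ = _ := by ring
  linarith

theorem measurable_excessPhiRisk_comp {D : Type*} [MeasurableSpace D] (hφ : Continuous φ)
    {h : D → Score X K} (hh : Measurable (Function.uncurry h)) :
    Measurable fun d => excessPhiRisk P φ fstar (h d) := by
  refine Measurable.sub_const ?_ _
  have hm : Measurable fun p : D × (X × Fin K) => phiLoss φ (h p.1) p.2 := by
    refine Finset.measurable_sum _ fun k _ => hφ.measurable.comp ?_
    exact ((measurable_signedLabel k).comp measurable_snd).mul
      ((measurable_pi_apply k).comp (hh.comp (by fun_prop : Measurable
        fun p : D × (X × Fin K) => (p.1, p.2.1))))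
  exact (hm.stronglyMeasurable.integral_prod_right (ν := P)).measurable

theorem exists_abs_excessPhiRisk_le (hφ : Continuous φ) :
    ∃ C, ∀ f : Score X K, (∀ x k, |f x k| ≤ B) → |excessPhiRisk P φ fstar f| ≤ C := by
  obtain ⟨C, hC⟩ := exists_abs_phiLoss_le (X := X) (K := K) hφ (B := B)
  refine ⟨C + |phiRisk P φ fstar|, fun f hf => (abs_sub _ _).trans ?_⟩
  have := norm_integral_le_of_norm_le_const (μ := P) (f := phiLoss φ f)
    (ae_of_all _ fun z => hC f hf z)
  rw [probReal_univ, mul_one] at this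
  gcongr
  exact this

theorem integrable_excessPhiRisk_comp {D : Type*} [MeasurableSpace D] {Q : Measure D}
    [IsFiniteMeasure Q] (hφ : Continuous φ) {h : D → Score X K}
    (hh : Measurable (Function.uncurry h)) (hB : ∀ d x k, |h d x k| ≤ B) :
    Integrable (fun d => excessPhiRisk P φ fstar (h d)) Q := by
  obtain ⟨C, hC⟩ := exists_abs_excessPhiRisk_le (P := P) (fstar := fstar) (B := B) hφ
  exact Integrable.of_bound (measurable_excessPhiRisk_comp hφ hh).aestronglyMeasurable C
    (ae_of_all _ fun d => hC _ (hB d))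

/-- The excess risk of an empirical minimizer, up to the discretization error, is dominated by a
one-sided deviation at some point of the net. -/
theorem excess_sub_le_deviation (hφ : Continuous φ) (hL : LipschitzOnWith L φ (Icc (-B) B))
    (hFm : ∀ f ∈ F, Measurable f) (hFB : ∀ f ∈ F, ∀ x k, |f x k| ≤ B) (hn : 0 < n)
    {d : Fin n → X × Fin K} {f f' g : Score X K} (hf : f ∈ F) (hf' : f' ∈ F)
    (hmin : ∀ g ∈ F, empPhiRisk φ d f ≤ empPhiRisk φ d g) (hg : g ∈ F)
    (hclose : ∀ x k, |f x k - f' x k| ≤ 2 * (1 / n)) :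
    n * (excessPhiRisk P φ fstar f - excessPhiRisk P φ fstar g) - 6 * K * L ≤
      n * (excessPhiRisk P φ fstar f' - excessPhiRisk P φ fstar g) -
        2 * ∑ i, (phiLoss φ f' (d i) - phiLoss φ g (d i)) := by
  have hn' : (0 : ℝ) < n := by exact_mod_cast hn
  have hpt := abs_phiLoss_sub_le_of_forall_le hL (hFB f hf) (hFB f' hf') hclose
  have hfi := integrable_phiLoss (P := P) hφ (hFm f hf) (hFB f hf)
  have hfi' := integrable_phiLoss (P := P) hφ (hFm f' hf') (hFB f' hf')
  have h1 : excessPhiRisk P φ fstar f - excessPhiRisk P φ fstar f' ≤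
      L * (K * (2 * (1 / n))) := by
    have h := norm_integral_le_of_norm_le_const (μ := P)
      (f := fun z => phiLoss φ f z - phiLoss φ f' z) (ae_of_all _ hpt)
    rw [integral_sub hfi hfi', probReal_univ, mul_one] at h
    have := (abs_le.1 h).2
    unfold excessPhiRisk phiRisk
    linarith
  have h2 : ∑ i, phiLoss φ f' (d i) ≤ ∑ i, phiLoss φ f (d i) + n * (L * (K * (2 * (1 / n)))) := by
    have : ∑ i, phiLoss φ f' (d i) ≤ ∑ i, (phiLoss φ f (d i) + L * (K * (2 * (1 / n)))) :=
      Finset.sum_le_sum fun i _ => by linarith [(abs_le.1 (hpt (d i))).1]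
    simpa [Finset.sum_add_distrib] using this
  have h3 : ∑ i, phiLoss φ f (d i) ≤ ∑ i, phiLoss φ g (d i) :=
    le_of_mul_le_mul_left (hmin g hg) (by positivity : (0 : ℝ) < 1 / n)
  -- Replacing `f` by `f'` costs `2KL` in the risk and `2KL` in the empirical sum; the latter counts
  -- twice, hence `6KL`.
  have h4 : n * (L * (K * (2 * (1 / n)))) = 2 * K * (L : ℝ) := by field_simp
  rw [Finset.sum_sub_distrib]
  have h5 := mul_le_mul_of_nonneg_left h1 hn'.le
  rw [h4] at h2 h5
  linarith

/-- Fast rate for the excess `φ`-risk of an empirical risk minimizer. -/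
theorem integral_excessPhiRisk_erm_le [NeZero K] (hφ : ConvexOn ℝ univ φ)
    (hL : LipschitzOnWith L φ (Icc (-B) B)) (hB : 0 ≤ B)
    (hc₁ : 0 < c₁) (hF : Convex ℝ F) (hFm : ∀ f ∈ F, Measurable f)
    (hFB : ∀ f ∈ F, ∀ x k, |f x k| ≤ B) (hmin : IsPhiMinimizer P φ fstar)
    (hmod : ∀ ε : ℝ, 0 < ε → ((c₁ * ε ^ 2 : ℝ) : EReal) ≤ convexityModulus P φ F ε) (hn : 0 < n)
    (h2 : 2 ≤ supCoveringNumber (1 / (n : ℝ≥0)) F)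
    (htop : supCoveringNumber (1 / (n : ℝ≥0)) F ≠ ⊤)
    {fhat : (Fin n → X × Fin K) → Score X K} (herm : IsERM φ F fhat) :
    ∫ d, excessPhiRisk P φ fstar (fhat d) ∂Measure.pi (fun _ : Fin n => P) ≤
      sInf (excessPhiRisk P φ fstar '' F) +
        (1 + 4 * B * L + 2 * L ^ 2 / c₁ + 6 * L / Real.log 2) *
          (K * Real.log ((supCoveringNumber (1 / (n : ℝ≥0)) F).toNat : ℝ) / n) := by
  have hφc := continuous_of_convexOn hφ
  have hK : (0 : ℝ) < K := by exact_mod_cast Nat.pos_of_ne_zero (NeZero.ne K)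
  have hn' : (0 : ℝ) < n := by exact_mod_cast hn
  set M := (supCoveringNumber (1 / (n : ℝ≥0)) F).toNat with hM
  have hM2 : (2 : ℝ) ≤ M := by
    have h : ((2 : ℕ) : ℕ∞) ≤ (M : ℕ∞) := by rw [hM, ENat.natCast_toNat htop]; exact h2
    exact_mod_cast h
  have hlog2 : 0 < Real.log 2 := Real.log_pos (by norm_num)
  have hlogM : Real.log 2 ≤ Real.log M := Real.log_le_log (by norm_num) hM2
  set ρ := sInf (excessPhiRisk P φ fstar '' F) with hρdef
  have hbdd : BddBelow (excessPhiRisk P φ fstar '' F) := ⟨0, by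
    rintro _ ⟨f, hf, rfl⟩
    exact excessPhiRisk_nonneg hφ hmin (hFm f hf) (hFB f hf)⟩
  have hρ : ∀ f ∈ F, ρ ≤ excessPhiRisk P φ fstar f := fun f hf =>
    csInf_le hbdd (mem_image_of_mem _ hf)
  obtain ⟨T, hTF, hTM, hT⟩ := exists_finset_net htop
  -- The empty class has covering number zero.
  have hFne : F.Nonempty := by
    rw [nonempty_iff_ne_empty]
    rintro rfl
    simp [supCoveringNumber] at h2
  set a := 1 + 4 * B * L + 2 * L ^ 2 / c₁ with ha
  have hL0 : (0 : ℝ) ≤ L := L.coe_nonneg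
  have ha1 : 4 * B * L ≤ a := by have : 0 ≤ 2 * L ^ 2 / c₁ := by positivity
                                 linarith
  have ha2 : 2 * L ^ 2 / c₁ ≤ a := by have : 0 ≤ 4 * B * L := by positivity
                                      linarith
  have ha0 : 0 < a := by positivity
  -- A scale small enough for both the boundedness and the variance constraints on the exponential
  -- moment.
  set l := 1 / (a * K) with hl
  have hl0 : 0 < l := by positivity
  have hlB : l * (4 * B * L * K) ≤ 1 := by
    rw [hl, one_div, inv_mul_le_iff₀ (by positivity)]; nlinarith
  have hlc : l * (2 * L ^ 2 / c₁ * K) ≤ 1 := by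
    rw [hl, one_div, inv_mul_le_iff₀ (by positivity)]; nlinarith
  set Q := Measure.pi (fun _ : Fin n => P) with hQ
  have hEi : Integrable (fun d => excessPhiRisk P φ fstar (fhat d)) Q :=
    integrable_excessPhiRisk_comp hφc herm.measurable fun d => hFB _ (herm.mem d)
  refine le_of_forall_pos_le_add fun η hη => ?_
  -- The infimum need not be attained, so the reference score is a near-minimizer. One third of `η`
  -- is lost here and two thirds in the exponential moment.
  obtain ⟨_, ⟨g, hg, rfl⟩, hgη⟩ := exists_lt_of_csInf_lt (hFne.image _)
    (lt_add_of_pos_right ρ (by positivity : 0 < η / 3))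
  set W : (Fin n → X × Fin K) → ℝ := fun d =>
    l * (n * (excessPhiRisk P φ fstar (fhat d) - excessPhiRisk P φ fstar g) - 6 * K * L) with hW
  have hWi : Integrable W Q :=
    (((hEi.sub (integrable_const _)).const_mul _).sub (integrable_const _)).const_mul _
  have hWm : Measurable W := by
    have := measurable_excessPhiRisk_comp (P := P) (fstar := fstar) hφc herm.measurable
    exact (((this.sub_const _).const_mul _).sub_const _).const_mul _
  have hexp : Integrable (fun d => Real.exp (W d)) Q := by
    obtain ⟨C, hC⟩ := exists_abs_excessPhiRisk_le (P := P) (fstar := fstar) (B := B) hφc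
    refine Integrable.of_bound hWm.exp.aestronglyMeasurable
      (Real.exp (l * (n * (C - excessPhiRisk P φ fstar g) - 6 * K * L))) (ae_of_all _ fun d => ?_)
    rw [Real.norm_eq_abs, Real.abs_exp, Real.exp_le_exp]
    have := (abs_le.1 (hC _ (hFB _ (herm.mem d)))).2
    simp only [hW]
    gcongr
  have hjint : ∀ f ∈ T, Integrable (fun d : Fin n → X × Fin K => Real.exp (l *
      (n * (excessPhiRisk P φ fstar f - excessPhiRisk P φ fstar g) -
        2 * ∑ i, (phiLoss φ f (d i) - phiLoss φ g (d i))))) Q := by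
    intro f hf
    have hfF := hTF hf
    have hDm : Measurable fun z => phiLoss φ f z - phiLoss φ g z :=
      (measurable_phiLoss hφc (hFm f hfF)).sub (measurable_phiLoss hφc (hFm g hg))
    refine Integrable.of_bound (Measurable.aestronglyMeasurable ?_) (Real.exp (l *
      (n * (excessPhiRisk P φ fstar f - excessPhiRisk P φ fstar g) -
        2 * ∑ i : Fin n, -(L * (K * (2 * B))))))
      (ae_of_all _ fun d => ?_)
    · exact (((Finset.measurable_sum _ fun i _ =>
        hDm.comp (measurable_pi_apply i)).const_mul 2).const_sub _ |>.const_mul l).exp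
    · rw [Real.norm_eq_abs, Real.abs_exp, Real.exp_le_exp]
      gcongr with i
      exact (abs_le.1 (abs_phiLoss_sub_le_bound hL (hFB f hfF) (hFB g hg) (d i))).1
  -- The net point close to the minimizer depends on `d`; bounding its exponential by the sum over
  -- the net costs the factor `M`.
  have hexp_le : ∫ d, Real.exp (W d) ∂Q ≤ Real.exp (Real.log M + n * (2 * l * (η / 3))) := by
    calc ∫ d, Real.exp (W d) ∂Q
        ≤ ∫ d, ∑ f ∈ T, Real.exp (l *
          (n * (excessPhiRisk P φ fstar f - excessPhiRisk P φ fstar g) -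
            2 * ∑ i, (phiLoss φ f (d i) - phiLoss φ g (d i)))) ∂Q := by
          refine integral_mono hexp (integrable_finsetSum _ hjint) fun d => ?_
          obtain ⟨f, hf, hclose⟩ := hT _ (herm.mem d)
          refine le_trans ?_ (Finset.single_le_sum (f := fun f => Real.exp (l *
            (n * (excessPhiRisk P φ fstar f - excessPhiRisk P φ fstar g) -
            2 * ∑ i, (phiLoss φ f (d i) - phiLoss φ g (d i)))))
            (fun _ _ => (Real.exp_pos _).le) hf)
          refine Real.exp_le_exp.2 (mul_le_mul_of_nonneg_left ?_ hl0.le)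
          exact excess_sub_le_deviation hφc hL hFm hFB hn (herm.mem d) (hTF hf) (herm.le d) hg
            (by simpa using hclose)
      _ = ∑ f ∈ T, ∫ d, Real.exp (l *
          (n * (excessPhiRisk P φ fstar f - excessPhiRisk P φ fstar g) -
            2 * ∑ i, (phiLoss φ f (d i) - phiLoss φ g (d i)))) ∂Q :=
          integral_finsetSum _ hjint
      _ ≤ ∑ f ∈ T, Real.exp (n * (2 * l * (η / 3))) :=
          Finset.sum_le_sum fun f hf => integral_exp_excess_sub_le hφc hL hc₁ hF hFm hFB hmod hρ
            (hTF hf) hg hgη.le (by positivity) hl0.le hlB hlc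
      _ = T.card * Real.exp (n * (2 * l * (η / 3))) := by simp
      _ ≤ M * Real.exp (n * (2 * l * (η / 3))) := by
          gcongr
      _ = _ := by rw [Real.exp_add, Real.exp_log (by linarith)]
  have hW_le := integral_le_log_of_integral_exp_le hWi hexp hexp_le
  have hW_eq : ∫ d, W d ∂Q =
      l * (n * (∫ d, excessPhiRisk P φ fstar (fhat d) ∂Q - excessPhiRisk P φ fstar g) -
        6 * K * L) := by
    have hi : Integrable (fun d => n * (excessPhiRisk P φ fstar (fhat d) -
        excessPhiRisk P φ fstar g)) Q := (hEi.sub (integrable_const _)).const_mul _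
    simp only [hW]
    rw [integral_const_mul, integral_sub hi (integrable_const _), integral_const_mul, integral_sub hEi (integrable_const _)]
    simp
  rw [hW_eq] at hW_le
  set E := ∫ d, excessPhiRisk P φ fstar (fhat d) ∂Q
  have h3 : n * (E - excessPhiRisk P φ fstar g) - 6 * K * L ≤
      a * K * Real.log M + n * (2 * (η / 3)) := by
    refine le_of_mul_le_mul_left (hW_le.trans (le_of_eq ?_)) hl0
    rw [hl]; field_simp
  -- The discretization error is absorbed because `M ≥ 2` gives `log M ≥ log 2`.
  have h4 : 6 * K * (L : ℝ) ≤ 6 * L / Real.log 2 * (K * Real.log M) := by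
    calc 6 * K * (L : ℝ) = 6 * L / Real.log 2 * (K * Real.log 2) := by field_simp
      _ ≤ _ := by gcongr
  have h5 : n * (E - excessPhiRisk P φ fstar g) ≤
      n * ((a + 6 * L / Real.log 2) * (K * Real.log M / n) + 2 * (η / 3)) := by
    calc n * (E - excessPhiRisk P φ fstar g)
        ≤ a * K * Real.log M + 6 * L / Real.log 2 * (K * Real.log M) + n * (2 * (η / 3)) := by
          linarith
      _ = _ := by field_simp
  have h6 := le_of_mul_le_mul_left h5 hn'
  linarith

end ERM

end ConfSet

/-! ### Assembly of the bound -/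

namespace ConfSet

theorem abs_risk_empSet_sub_le {X : Type*} [MeasurableSpace X] {K : ℕ} [NeZero K]
    {P : Measure (X × Fin K)} [IsProbabilityMeasure P] {φ : ℝ → ℝ} {f fstar : Score X K}
    {β δ α s c₂ C₀ r B : ℝ} {N : ℕ} (hN : 0 < N) (hα : 0 < α) (hs : 0 < s) (hC₀ : 0 < C₀)
    (hr : 0 < r) (hβ : β ∈ Set.Ioo (0 : ℝ) K)
    (hcp : ∀ k, Continuous (scoreCDF P.fst (condProb P) k))
    (hφ : ConvexOn ℝ Set.univ φ) (hmin : IsPhiMinimizer P φ fstar)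
    (hδ : ∀ᵐ x ∂P.fst, thresholdSet fstar δ x = oracleSet P β x)
    (hcal : ∀ k, ∀ᵐ x ∂P.fst, |condProb P x k - oracleGInv P β| ^ s ≤
        C₀ * marginalExcess P φ fstar (fun _ _ => -δ) k x)
    (hmargin : ∀ k, MarginCondition P β α c₂ k)
    (hf : Measurable f) (hB : ∀ x k, |f x k| ≤ B) (hfr : excessPhiRisk P φ fstar f ≤ r)
    (hcf : ∀ k, Continuous (scoreCDF P.fst f k)) (u : Fin N → X) :
    |risk P (empSet u f β) - risk P (oracleSet P β)| ≤
      deviationBound P.fst f β (K / √N) u + 2 * (c₂ + C₀) * (K * (r / K) ^ (α / (α + s))) := by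
  have hK : (0 : ℝ) < K := by exact_mod_cast Nat.pos_of_ne_zero (NeZero.ne K)
  have ha : 0 < (K : ℝ) / √N := by positivity
  refine (abs_sub_le _ (risk P (levelSet P.fst f β)) _).trans (add_le_add ?_ ?_)
  · exact (abs_risk_sub_risk_le _ _).trans (sum_measureReal_empSet_symmDiff_le hN hf β ha u)
  · exact (abs_risk_sub_risk_le _ _).trans (sum_measureReal_levelSet_symmDiff_le hα hs hC₀ hr hβ
      hcp hφ hmin hδ hcal hmargin hf hB hfr hcf)

end ConfSet

open ConfSet in
theorem theorem2 :
    -- the absolute constant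
    ∃ C' : ℝ, 0 < C' ∧
    -- the parameters on which the other constant is allowed to depend
    ∀ (B : ℝ) (L : ℝ≥0) (s α c₁ c₂ C₀ : ℝ), 1 ≤ s → 0 < α → 0 < c₁ → 0 < c₂ → 0 < C₀ →
    ∃ C : ℝ, 0 < C ∧
    -- the model: `P` is the law of `(X, Y)`, and all `p_k(X)` have a continuous c.d.f.
    ∀ (X : Type*) [MeasurableSpace X] (K : ℕ) [NeZero K] (P : Measure (X × Fin K))
      [IsProbabilityMeasure P] (β : ℝ) (φ : ℝ → ℝ) (fstar : Score X K) (δstar : ℝ)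
      (F : Set (Score X K)) (n N : ℕ) (fhat : (Fin n → X × Fin K) → Score X K),
      2 ≤ K → 0 < n → 0 < N → β ∈ Set.Ioo (0 : ℝ) K →
      (∀ k, Continuous (scoreCDF P.fst (condProb P) k)) →
    -- the loss is convex, calibrated, and Lipschitz on the range of the scores
      ConvexOn ℝ Set.univ φ →
      LipschitzOnWith L φ (Set.Icc (-B) B) →
      IsPhiMinimizer P φ fstar →
      IsCalibrated P fstar →
      (∀ᵐ x ∂P.fst, thresholdSet fstar δstar x = oracleSet P β x) →
      (∀ k, ∀ᵐ x ∂P.fst, |condProb P x k - oracleGInv P β| ^ s ≤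
        C₀ * marginalExcess P φ fstar (fun _ _ => -δstar) k x) →
    -- the margin conditions
      (∀ k, MarginCondition P β α c₂ k) →
    -- the class of scores is convex and bounded by `B`, with a finite covering number `M_n ≥ 2`
      Convex ℝ F →
      (∀ f ∈ F, Measurable f) →
      (∀ f ∈ F, ∀ x k, |f x k| ≤ B) →
      2 ≤ supCoveringNumber (1 / (n : ℝ≥0)) F →
      supCoveringNumber (1 / (n : ℝ≥0)) F ≠ ⊤ →
    -- the modulus of convexity of the `φ`-risk is at least quadratic
      (∀ ε : ℝ, 0 < ε → ((c₁ * ε ^ 2 : ℝ) : EReal) ≤ convexityModulus P φ F ε) →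
    -- the empirical minimizer, whose scores have continuous c.d.f.s given the labeled sample
      IsERM φ F fhat →
      (∀ᵐ d ∂Measure.pi (fun _ : Fin n => P), ∀ k,
        Continuous (scoreCDF P.fst (fhat d) k)) →
    -- the bound
      ∫ w, |risk P (empSet w.2 (fhat w.1) β) - risk P (oracleSet P β)|
          ∂((Measure.pi (fun _ : Fin n => P)).prod (Measure.pi (fun _ : Fin N => P.fst))) ≤
        C * (K : ℝ) ^ (1 - α / (α + s)) *
          (sInf (excessPhiRisk P φ fstar '' F) +
            K * Real.log ((supCoveringNumber (1 / (n : ℝ≥0)) F).toNat : ℝ) / n) ^ (α / (α + s)) +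
        C' * (K / Real.sqrt N) := by
  refine ⟨2 * Real.pi, by positivity, fun B L s α c₁ c₂ C₀ hs hα hc₁ hc₂ hC₀ => ?_⟩
  set γ := α / (α + s) with hγ
  have hαs : 0 < α + s := by linarith
  have hγ0 : 0 ≤ γ := by positivity
  have hγ1 : γ ≤ 1 := by rw [hγ, div_le_one hαs]; linarith
  -- One more than the constant of the fast rate, to leave room for the extra `κ` below. The
  -- absolute value keeps it positive, since `B` is not yet known to be nonnegative.
  set b : ℝ := 2 + 4 * |B| * L + 2 * L ^ 2 / c₁ + 6 * L / Real.log 2 with hb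
  have hlog2 : 0 < Real.log 2 := Real.log_pos (by norm_num)
  have hL0 : (0 : ℝ) ≤ L := L.coe_nonneg
  have hb1 : 1 ≤ b := by
    have : 0 ≤ 4 * |B| * L + 2 * L ^ 2 / c₁ + 6 * L / Real.log 2 := by positivity
    linarith
  refine ⟨2 * (c₂ + C₀) * b ^ γ, by positivity, ?_⟩
  intro X _ K _ P _ β φ fstar δstar F n N fhat hK hn hN hβ hcp hφ hL hmin _ hδ hcal hmargin hF
    hFm hFB h2 htop hmod herm hcf
  have hK0 : (0 : ℝ) < K := by positivity
  have hn0 : (0 : ℝ) < n := by positivity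
  set M := (supCoveringNumber (1 / (n : ℝ≥0)) F).toNat with hM
  have hM2 : (2 : ℝ) ≤ M := by
    have h : ((2 : ℕ) : ℕ∞) ≤ (M : ℕ∞) := by rw [hM, ENat.natCast_toNat htop]; exact h2
    exact_mod_cast h
  have hlogM : 0 < Real.log M := Real.log_pos (by linarith)
  set ρ := sInf (excessPhiRisk P φ fstar '' F) with hρdef
  -- Adding `κ` to the excess risk supplies the strictly positive bound `r` that the comparison
  -- requires, without changing the rate.
  set κ := K * Real.log M / n with hκ
  have hκ0 : 0 < κ := by positivity
  have hnonneg : ∀ f ∈ F, 0 ≤ excessPhiRisk P φ fstar f := fun f hf =>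
    excessPhiRisk_nonneg hφ hmin (hFm f hf) (hFB f hf)
  have hρ0 : 0 ≤ ρ := Real.sInf_nonneg (by rintro _ ⟨f, hf, rfl⟩; exact hnonneg f hf)
  set Q := Measure.pi (fun _ : Fin n => P) with hQ
  set U := Measure.pi (fun _ : Fin N => P.fst) with hU
  have hφc := continuous_of_convexOn hφ
  have hfB := fun d => hFB _ (herm.mem d)
  have hfm := fun d => hFm _ (herm.mem d)
  obtain ⟨z₀⟩ : Nonempty (X × Fin K) := nonempty_of_isProbabilityMeasure P
  have hB0 : 0 ≤ B := (abs_nonneg _).trans (hfB (fun _ => z₀) z₀.1 z₀.2)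
  set E : (Fin n → X × Fin K) → ℝ := fun d => excessPhiRisk P φ fstar (fhat d) with hE
  have hE0 : ∀ d, 0 ≤ E d := fun d => hnonneg _ (herm.mem d)
  have hEi : Integrable E Q := integrable_excessPhiRisk_comp hφc herm.measurable hfB
  have hEm : Measurable E := measurable_excessPhiRisk_comp hφc herm.measurable
  -- the rate attained at the labeled sample `d`
  set R : (Fin n → X × Fin K) → ℝ := fun d =>
    2 * (c₂ + C₀) * (K * ((E d + κ) / K) ^ γ) with hR
  set T : (Fin n → X × Fin K) × (Fin N → X) → ℝ := fun w =>
    deviationBound P.fst (fhat w.1) β (K / √N) w.2 with hT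
  have ha : 0 < (K : ℝ) / √N := by positivity
  have hrpowi : Integrable (fun d => ((E d + κ) / K) ^ γ) Q := by
    have hi : Integrable (fun d => 1 + (E d + κ) / K) Q :=
      (integrable_const _).add ((hEi.add (integrable_const _)).div_const _)
    refine hi.mono' (((hEm.add_const κ).div_const _).pow_const γ).aestronglyMeasurable
      (Filter.Eventually.of_forall fun d => ?_)
    have h0 : 0 ≤ (E d + κ) / K := by have := hE0 d; positivity
    rw [Real.norm_eq_abs, abs_of_nonneg (Real.rpow_nonneg h0 _)]
    rcases le_total ((E d + κ) / K) 1 with h | h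
    · exact (Real.rpow_le_one h0 h hγ0).trans (by linarith)
    · exact (Real.rpow_le_rpow_of_exponent_le h hγ1).trans (by rw [Real.rpow_one]; linarith)
  have hRi : Integrable R Q := (hrpowi.const_mul _).const_mul _
  have hTi : Integrable T (Q.prod U) := by
    refine Integrable.of_bound (measurable_deviationBound herm.measurable β _).aestronglyMeasurable
      (K * (((K / √N) ^ 2 + (K : ℝ) ^ 2) / (K / √N) ^ 2)) (Filter.Eventually.of_forall fun w => ?_)
    have h := deviationBound_mem_Icc (μ := P.fst) hN (fhat w.1) ha β w.2
    rw [Real.norm_eq_abs, abs_of_nonneg h.1]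
    exact h.2
  have hcf' : ∀ᵐ w ∂Q.prod U, ∀ k, Continuous (scoreCDF P.fst (fhat w.1) k) :=
    Measure.quasiMeasurePreserving_fst.ae hcf
  have hbound : ∫ w, |risk P (empSet w.2 (fhat w.1) β) - risk P (oracleSet P β)| ∂(Q.prod U) ≤
      ∫ w, (T w + R w.1) ∂(Q.prod U) := by
    -- Only the dominating function has to be integrable; measurability of the risk difference in
    -- the samples is not needed.
    refine integral_mono_of_nonneg (Filter.Eventually.of_forall fun w => abs_nonneg _)
      (hTi.add (hRi.comp_fst U)) ?_
    filter_upwards [hcf'] with w hw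
    exact abs_risk_empSet_sub_le hN hα (by linarith) hC₀ (by have := hE0 w.1; linarith) hβ hcp hφ
      hmin hδ hcal hmargin (hfm w.1) (hfB w.1) (le_add_of_nonneg_right hκ0.le) hw w.2
  have hTint : ∫ w, T w ∂(Q.prod U) ≤ 2 * Real.pi * (K / √N) := by
    rw [integral_prod T hTi]
    refine (integral_mono_ae hTi.integral_prod_left
      (integrable_const (2 * Real.pi * (K / √N))) ?_).trans (le_of_eq (by simp))
    filter_upwards [hcf] with d hd
    exact integral_deviationBound_le hN (by omega) (hfm d) hd β
  have hEle : ∫ d, E d ∂Q ≤ ρ + (b - 1) * κ := by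
    have h := integral_excessPhiRisk_erm_le hφ hL hB0 hc₁ hF hFm hFB hmin hmod hn h2 htop herm
    rw [hb, abs_of_nonneg hB0]
    refine h.trans (le_of_eq ?_)
    simp only [hκ, hM, hρdef]
    ring
  have hRint : ∫ w, R w.1 ∂(Q.prod U) ≤
      2 * (c₂ + C₀) * b ^ γ * (K : ℝ) ^ (1 - γ) * (ρ + κ) ^ γ := by
    rw [integral_fun_fst R]
    simp only [probReal_univ, one_smul, hR]
    rw [integral_const_mul, integral_const_mul]
    have hjensen : ∫ d, ((E d + κ) / K) ^ γ ∂Q ≤ (∫ d, (E d + κ) / K ∂Q) ^ γ :=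
      (Real.concaveOn_rpow hγ0 hγ1).le_map_integral
        (Real.continuous_rpow_const hγ0).continuousOn isClosed_Ici
        (Filter.Eventually.of_forall fun d => by
          have := hE0 d; exact Set.mem_Ici.2 (by positivity))
        ((hEi.add (integrable_const _)).div_const _) hrpowi
    -- Since `b ≥ 1` and `ρ ≥ 0`, `ρ + (b - 1) κ + κ ≤ b (ρ + κ)`.
    have hmean : ∫ d, (E d + κ) / K ∂Q ≤ b * (ρ + κ) / K := by
      rw [integral_div, integral_add hEi (integrable_const _)]
      simp only [integral_const, probReal_univ, one_smul]
      gcongr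
      nlinarith
    have hmean0 : 0 ≤ ∫ d, (E d + κ) / K ∂Q := integral_nonneg fun d => by
      have := hE0 d; simp only [Pi.zero_apply]; positivity
    calc 2 * (c₂ + C₀) * (K * ∫ d, ((E d + κ) / K) ^ γ ∂Q)
        ≤ 2 * (c₂ + C₀) * (K * (b * (ρ + κ) / K) ^ γ) := by
          gcongr
          exact hjensen.trans (Real.rpow_le_rpow hmean0 hmean hγ0)
      _ = 2 * (c₂ + C₀) * b ^ γ * (K : ℝ) ^ (1 - γ) * (ρ + κ) ^ γ := by
          rw [Real.div_rpow (by positivity) hK0.le, Real.mul_rpow (by positivity) (by positivity),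
            Real.rpow_sub hK0, Real.rpow_one]
          ring
  calc _ ≤ ∫ w, (T w + R w.1) ∂(Q.prod U) := hbound
    _ = ∫ w, T w ∂(Q.prod U) + ∫ w, R w.1 ∂(Q.prod U) := integral_add hTi (hRi.comp_fst U)
    _ ≤ _ := by linarith
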